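/- Let $a>0$ and let $S=\{S(t),t\ge 0\}$ be the simple symmetric continuous-time random walk on $\mathbb{Z}$ with jump rate $a$ (right-continuous version): it stays at each visited point for an exponential time with parameter $a$ and then jumps to one of the two neighbouring points with probability $1/2$ each, independently of the past. Put $\tau:=\inf\{t\ge 0: S(t)\ne S(0)\}$ and, for $y,z\in\mathbb{Z}$ with $y\ne z$, $$\tau_{y,z}:=\inf\{t\ge\tau: S(t)=y,\ S(u)\ne z \text{ for all } \tau\le u\le t\}\qquad(\inf\varnothing=\infty),$$ the hitting time of $y$ with taboo state $z$. For $x\in\mathbb{Z}$ and $t\ge 0$ let $H_{x,y,z}(t):=\mathsf{P}(\tau_{y,z}\le t\mid S(0)=x)$ (where $\mathsf{P}(S(0)=x)>0$). Then for all $x,y,z\in\mathbb{Z}$ with $y\neq z$ there is an $\varepsilon\in(0,1)$ such that, with all limits taken as $t\to\infty$: 1. if $x<y<z$ or $z<y<x$, then $1-H_{x,y,z}(t)\sim\dfrac{\sqrt2\,|y-x|}{\sqrt{a\pi}\,\sqrt t}$; 2. if $x=y$, then $1-\dfrac{1}{2|y-z|}-H_{y,y,z}(t)\sim\dfrac{1}{\sqrt{2a\pi}\,\sqrt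 t}$; 3. if $z<x<y$ or $y<x<z$, then $\dfrac{x-z}{y-z}-H_{x,y,z}(t)=o(e^{-a\varepsilon t})$; 4. if $x=z$, then $\dfrac{1}{2|y-z|}-H_{z,y,z}(t)=o(e^{-a\varepsilon t})$; 5. if $x<z<y$ or $y<z<x$, then $H_{x,y,z}(t)=0$ for all $t\ge 0$. -/

import Mathlib

open MeasureTheory ProbabilityTheory Filter Asymptotics
open scoped NNReal ENNReal

noncomputable section

/-- The generator of the simple (symmetric, nearest-neighbour) random walk on `ℤ` which leaves
every point at rate `a` and jumps to each of its two neighbours at rate `a / 2`. -/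
def simpleGenerator (a : ℝ) (x y : ℤ) : ℝ :=
  if y = x then -a else if |y - x| = 1 then a / 2 else 0

/-- The jump rate `-A 0 0` of a space-homogeneous generator `A`. -/
def jumpRate (A : ℤ → ℤ → ℝ) : ℝ := -A 0 0

/-- The one-step transition probabilities of the embedded chain of a space-homogeneous
generator `A`. -/
def embeddedProb (A : ℤ → ℤ → ℝ) (x y : ℤ) : ℝ :=
  if x = y then 0 else A x y / jumpRate A

/-- `S` is, on the probability space `(Ω, P)`, the (regular, right-continuous) continuous-time
random walk on `ℤ` with space-homogeneous generator `A` and arbitrary initial law: there are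
an embedded discrete-time Markov chain `Y` with transition probabilities `embeddedProb A` and
holding times `T 0, T 1, …`, which are independent, exponential with parameter `jumpRate A`,
and independent of `Y`, such that almost surely `S t = Y n` as long as
`T 0 + ⋯ + T (n - 1) ≤ t < T 0 + ⋯ + T n`. -/
structure IsRandomWalk {Ω : Type*} [MeasurableSpace Ω] (A : ℤ → ℤ → ℝ)
    (S : ℝ≥0 → Ω → ℤ) (P : Measure Ω) : Prop where
  measurable : ∀ t, Measurable (S t)
  exists_jumps : ∃ (Y : ℕ → Ω → ℤ) (T : ℕ → Ω → ℝ),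
    (∀ n, Measurable (Y n)) ∧ (∀ n, Measurable (T n)) ∧
    (∀ (n : ℕ) (s : ℕ → ℤ), P {ω | ∀ i ≤ n, Y i ω = s i} =
      P {ω | Y 0 ω = s 0} *
        ∏ i ∈ Finset.range n, ENNReal.ofReal (embeddedProb A (s i) (s (i + 1)))) ∧
    (∀ n, P.map (T n) = expMeasure (jumpRate A)) ∧
    iIndepFun T P ∧
    IndepFun (fun ω n => T n ω) (fun ω n => Y n ω) P ∧
    ∀ᵐ ω ∂P, ∀ (n : ℕ) (t : ℝ≥0),
      ∑ i ∈ Finset.range n, T i ω ≤ (t : ℝ) → (t : ℝ) < ∑ i ∈ Finset.range (n + 1), T i ω →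
        S t ω = Y n ω

/-- The time `inf {t ≥ 0 : s t ≠ s 0}` of the first exit of a trajectory `s` from its starting
point (`∞` if there is none). -/
def exitTime (s : ℝ≥0 → ℤ) : ℝ≥0∞ :=
  sInf ((fun t : ℝ≥0 => (t : ℝ≥0∞)) '' {t | s t ≠ s 0})

/-- The hitting time of the state `y` with the taboo state `z`, with `τ = exitTime s`:
`inf {t ≥ τ : s t = y, s u ≠ z for τ ≤ u ≤ t}` (`∞` if there is no such `t`). -/
def tabooHittingTime (y z : ℤ) (s : ℝ≥0 → ℤ) : ℝ≥0∞ :=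
  sInf ((fun t : ℝ≥0 => (t : ℝ≥0∞)) ''
    {t | exitTime s ≤ t ∧ s t = y ∧ ∀ u : ℝ≥0, exitTime s ≤ u → u ≤ t → s u ≠ z})

/-- `H_{x,y,z}(t) = P(τ_{y,z} ≤ t | S 0 = x)`, the (improper) distribution function of the
hitting time of `y` with taboo state `z` given the starting point `x`. -/
def tabooCDF {Ω : Type*} [MeasurableSpace Ω] (S : ℝ≥0 → Ω → ℤ) (P : Measure Ω)
    (x y z : ℤ) (t : ℝ≥0) : ℝ :=
  (P[|{ω | S 0 ω = x}]).real {ω | tabooHittingTime y z (fun u => S u ω) ≤ t}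

end

/-! The holding times are i.i.d. exponential and independent of the embedded chain, so the number of
jumps up to time `t` is Poisson with parameter `a * t`. Hence the taboo distribution function at `t`
is the Poisson average of the discrete probabilities `returnProb` (`tabooCDF_eq_poissonMix`), and
everything reduces to the behaviour of these in the number `n` of steps. Reflecting the line, one
may take `y < z`.

From below `y` the taboo is irrelevant, and the probability of not yet having hit is `survival n (y
- x)`. The reflection principle and Wallis' product give its asymptotics `d √(2 / (π n))` with `d =
y - x` (`tendsto_sqrt_mul_survival`). Between `y` and `z` the walk leaves the interval geometrically
fast, so the hitting probabilities approach the linear ruin probability geometrically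
(`ruin_sub_hitProb_mem_Icc`). Beyond `z` they vanish. Starts at `y` or `z` are averages over the
first step: from `y`, half the mass sees the half-line and half the interval; from `z`, half is lost
and half sees the interval.

Two transfers return to continuous time. The Abelian theorem `tendsto_sqrt_mul_poissonMix` turns `c
/ √n` into `c / √l`, and the Poisson generating function turns `r ^ n` into `exp (-(1 - r) * l)`
(`abs_poissonMix_le`); the latter determines `ε`. -/

/-! ### Poisson averages of sequences -/

/-- The weight of `n` under the Poisson distribution with parameter `l`. -/
noncomputable def poissonWeight (l : ℝ) (n : ℕ) : ℝ := Real.exp (-l) * l ^ n / n.factorial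

/-- The expectation of `q` under the Poisson distribution with parameter `l`. -/
noncomputable def poissonMix (q : ℕ → ℝ) (l : ℝ) : ℝ := ∑' n, poissonWeight l n * q n

lemma poissonWeight_nonneg {l : ℝ} (hl : 0 ≤ l) (n : ℕ) : 0 ≤ poissonWeight l n := by
  unfold poissonWeight; positivity

lemma hasSum_poissonWeight_mul_pow (l r : ℝ) :
    HasSum (fun n => poissonWeight l n * r ^ n) (Real.exp (-(1 - r) * l)) := by
  have h := (NormedSpace.expSeries_div_hasSum_exp (𝔸 := ℝ) (l * r)).mul_left (Real.exp (-l))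
  rw [← Real.exp_eq_exp_ℝ, ← Real.exp_add] at h
  rw [show -(1 - r) * l = -l + l * r by ring]
  convert! h using 2 with n
  simp only [poissonWeight, mul_pow]; ring

lemma hasSum_poissonWeight (l : ℝ) : HasSum (poissonWeight l) 1 := by
  simpa using hasSum_poissonWeight_mul_pow l 1

lemma summable_poissonWeight_mul {l : ℝ} (hl : 0 ≤ l) {q : ℕ → ℝ} {B : ℝ} (hq : ∀ n, |q n| ≤ B) :
    Summable fun n => poissonWeight l n * q n := by
  refine Summable.of_norm_bounded ((hasSum_poissonWeight l).summable.mul_right B) fun n => ?_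
  rw [norm_mul, Real.norm_of_nonneg (poissonWeight_nonneg hl n)]
  exact mul_le_mul_of_nonneg_left (hq n) (poissonWeight_nonneg hl n)

lemma poissonMix_const_sub {l : ℝ} (hl : 0 ≤ l) {q : ℕ → ℝ} {B : ℝ} (hq : ∀ n, |q n| ≤ B)
    (c : ℝ) : poissonMix (fun n => c - q n) l = c - poissonMix q l := by
  have h1 := (hasSum_poissonWeight l).mul_right c
  have h2 := (summable_poissonWeight_mul hl hq).hasSum
  have h3 := (h1.sub h2).tsum_eq
  simp only [← mul_sub, one_mul] at h3
  exact h3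

lemma abs_poissonMix_le {l r C : ℝ} (hl : 0 ≤ l) {q : ℕ → ℝ}
    (hq : ∀ n, |q n| ≤ C * r ^ n) : |poissonMix q l| ≤ C * Real.exp (-(1 - r) * l) := by
  rw [← Real.norm_eq_abs, poissonMix]
  refine tsum_of_norm_bounded ((hasSum_poissonWeight_mul_pow l r).mul_left C) fun n => ?_
  rw [norm_mul, Real.norm_of_nonneg (poissonWeight_nonneg hl n)]
  calc _ ≤ poissonWeight l n * (C * r ^ n) :=
        mul_le_mul_of_nonneg_left (hq n) (poissonWeight_nonneg hl n)
    _ = _ := by ring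

/-- Size biasing: it yields the moments of `N` and of `1 / (N + 1)`, which are all that the
two-sided estimate of the mean of `1 / √(N + 1)` needs. -/
lemma poissonWeight_succ (l : ℝ) (n : ℕ) :
    poissonWeight l (n + 1) * (n + 1) = l * poissonWeight l n := by
  simp only [poissonWeight, Nat.factorial_succ, Nat.cast_mul, Nat.cast_succ, pow_succ]
  field_simp

lemma hasSum_poissonWeight_mul_self (l : ℝ) :
    HasSum (fun n => poissonWeight l n * (n : ℝ)) l := by
  have h : HasSum (fun n => poissonWeight l (n + 1) * ((n + 1 : ℕ) : ℝ)) l := by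
    simpa [poissonWeight_succ] using (hasSum_poissonWeight l).mul_left l
  simpa using (hasSum_nat_add_iff (f := fun n => poissonWeight l n * (n : ℝ)) 1).1 h

lemma hasSum_poissonWeight_div_succ {l : ℝ} (hl : 0 < l) :
    HasSum (fun n => poissonWeight l n / ((n : ℝ) + 1)) ((1 - Real.exp (-l)) / l) := by
  have h : HasSum (fun n => poissonWeight l (n + 1)) (1 - Real.exp (-l)) := by
    refine (hasSum_nat_add_iff (f := poissonWeight l) 1).2 ?_
    simpa [poissonWeight] using hasSum_poissonWeight l
  convert! h.div_const l using 2 with n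
  have := poissonWeight_succ l n
  have h2 : (n : ℝ) + 1 ≠ 0 := by positivity
  field_simp
  linarith

lemma abs_inv_sqrt_succ_le (n : ℕ) : |(√((n : ℝ) + 1))⁻¹| ≤ 1 := by
  rw [abs_of_nonneg (by positivity)]
  exact inv_le_one_of_one_le₀ (Real.one_le_sqrt.2 (by simp))

/-- AM-GM gives `1 / v ≤ (1 / √l + √l / v ^ 2) / 2` with `v = √(n + 1)`, and the mean of `1 / (N +
1)` is at most `1 / l`. -/
lemma poissonMix_inv_sqrt_le {l : ℝ} (hl : 0 < l) :
    poissonMix (fun n => (√((n : ℝ) + 1))⁻¹) l ≤ (√l)⁻¹ := by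
  have hs : 0 < √l := Real.sqrt_pos.2 hl
  have h1 := ((hasSum_poissonWeight l).mul_right ((√l)⁻¹ / 2)).add
    ((hasSum_poissonWeight_div_succ hl).mul_right (√l / 2))
  have h2 := hasSum_le (fun n => ?_)
    (summable_poissonWeight_mul hl.le abs_inv_sqrt_succ_le).hasSum h1
  · refine h2.trans ?_
    have : (1 - Real.exp (-l)) / l * (√l / 2) ≤ (√l)⁻¹ / 2 := by
      have h3 : (1 - Real.exp (-l)) / l ≤ 1 / l := by
        gcongr; linarith [Real.exp_pos (-l)]
      calc _ ≤ 1 / l * (√l / 2) := by gcongr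
        _ = _ := by
          field_simp
          rw [Real.sq_sqrt hl.le]
    linarith
  · have hw := poissonWeight_nonneg hl.le n
    have hn : 0 < √((n : ℝ) + 1) := by positivity
    rw [div_mul_eq_mul_div, mul_div_assoc, ← mul_add]
    refine mul_le_mul_of_nonneg_left ?_ hw
    set v := √((n : ℝ) + 1)
    have hv : (n : ℝ) + 1 = v ^ 2 := (Real.sq_sqrt (by positivity)).symm
    rw [hv, ← sub_nonneg]
    have : (√l)⁻¹ / 2 + √l / 2 / v ^ 2 - v⁻¹ = (v - √l) ^ 2 / (2 * √l * v ^ 2) := by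
      field_simp; ring
    rw [this]; positivity

/-- Jensen's inequality: the convex function `u ↦ 1 / √u` lies above its tangent at `u = l + 1`, the
mean of `N + 1`. -/
lemma le_poissonMix_inv_sqrt {l : ℝ} (hl : 0 ≤ l) :
    (√(l + 1))⁻¹ ≤ poissonMix (fun n => (√((n : ℝ) + 1))⁻¹) l := by
  have hs : 0 < √(l + 1) := Real.sqrt_pos.2 (by linarith)
  set s := √(l + 1) with hsdef
  have hs2 : l + 1 = s ^ 2 := (Real.sq_sqrt (by linarith)).symm
  have h1 := ((hasSum_poissonWeight l).mul_right (3 / (2 * s))).sub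
    (((hasSum_poissonWeight_mul_self l).add (hasSum_poissonWeight l)).mul_right (1 / (2 * s ^ 3)))
  have h2 := hasSum_le (fun n => ?_) h1
    (summable_poissonWeight_mul hl abs_inv_sqrt_succ_le).hasSum
  · refine le_trans (le_of_eq ?_) h2
    rw [hs2]; field_simp; ring
  · have hw := poissonWeight_nonneg hl n
    have hn : 0 < √((n : ℝ) + 1) := by positivity
    set v := √((n : ℝ) + 1)
    have hv : (n : ℝ) + 1 = v ^ 2 := (Real.sq_sqrt (by positivity)).symm
    have : poissonWeight l n * (3 / (2 * s)) -
        (poissonWeight l n * n + poissonWeight l n) * (1 / (2 * s ^ 3)) =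
        poissonWeight l n * (3 / (2 * s) - (n + 1) / (2 * s ^ 3)) := by ring
    rw [this]
    refine mul_le_mul_of_nonneg_left ?_ hw
    rw [hv, ← sub_nonneg]
    have : v⁻¹ - (3 / (2 * s) - v ^ 2 / (2 * s ^ 3)) =
        (v - s) ^ 2 * (v + 2 * s) / (2 * s ^ 3 * v) := by
      field_simp; ring
    rw [this]; positivity

lemma tendsto_sqrt_mul_poissonMix_inv_sqrt :
    Tendsto (fun l => √l * poissonMix (fun n => (√((n : ℝ) + 1))⁻¹) l) atTop (nhds 1) := by
  have h1 : Tendsto (fun l : ℝ => √(1 - (l + 1)⁻¹)) atTop (nhds 1) := by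
    have : Tendsto (fun l : ℝ => (l + 1)⁻¹) atTop (nhds 0) :=
      tendsto_inv_atTop_zero.comp (tendsto_atTop_add_const_right _ _ tendsto_id)
    simpa using (this.const_sub 1).sqrt
  refine tendsto_of_tendsto_of_tendsto_of_le_of_le' h1 tendsto_const_nhds ?_ ?_
  · filter_upwards [eventually_gt_atTop 0] with l hl
    have : 1 - (l + 1)⁻¹ = l / (l + 1) := by field_simp; ring
    rw [this, Real.sqrt_div hl.le, div_eq_mul_inv]
    exact mul_le_mul_of_nonneg_left (le_poissonMix_inv_sqrt hl.le) (Real.sqrt_nonneg _)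
  · filter_upwards [eventually_gt_atTop 0] with l hl
    calc _ ≤ √l * (√l)⁻¹ :=
          mul_le_mul_of_nonneg_left (poissonMix_inv_sqrt_le hl) (Real.sqrt_nonneg _)
      _ = 1 := mul_inv_cancel₀ (Real.sqrt_pos.2 hl).ne'

lemma tendsto_sqrt_mul_poissonWeight (n : ℕ) :
    Tendsto (fun l => √l * poissonWeight l n) atTop (nhds 0) := by
  have h := (Real.tendsto_pow_mul_exp_neg_atTop_nhds_zero (n + 1)).div_const (n.factorial : ℝ)
  rw [zero_div] at h
  refine tendsto_of_tendsto_of_tendsto_of_le_of_le' tendsto_const_nhds h ?_ ?_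
  · filter_upwards [eventually_ge_atTop 0] with l hl
    exact mul_nonneg (Real.sqrt_nonneg _) (poissonWeight_nonneg hl n)
  · filter_upwards [eventually_ge_atTop 1] with l hl
    have : √l ≤ l := (Real.sqrt_le_left (by linarith)).2 (by nlinarith)
    calc √l * poissonWeight l n ≤ l * poissonWeight l n :=
          mul_le_mul_of_nonneg_right this (poissonWeight_nonneg (by linarith) n)
      _ = _ := by unfold poissonWeight; ring

/-- An Abelian theorem: if `q n ~ c / √n`, its Poisson average is asymptotic to `c / √l`. -/
theorem tendsto_sqrt_mul_poissonMix {q : ℕ → ℝ} {c : ℝ}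
    (hq : Tendsto (fun n : ℕ => √((n : ℝ) + 1) * q n) atTop (nhds c)) :
    Tendsto (fun l => √l * poissonMix q l) atTop (nhds c) := by
  set v : ℕ → ℝ := fun n => (√((n : ℝ) + 1))⁻¹ with hvdef
  have hv1 (n : ℕ) : |v n| ≤ 1 := abs_inv_sqrt_succ_le n
  have hv0 (n : ℕ) : 0 ≤ v n := by positivity
  -- Write `q = v * (c + d)` with `d → 0`; the part `v * c` is covered by the squeeze above, and `v
  -- * d` must be negligible.
  set d : ℕ → ℝ := fun n => √((n : ℝ) + 1) * q n - c with hd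
  have hqd (n : ℕ) : q n = v n * c + v n * d n := by
    have : √((n : ℝ) + 1) ≠ 0 := by positivity
    simp only [hvdef, hd]; field_simp; ring
  have hd0 : Tendsto d atTop (nhds 0) := by simpa [hd] using hq.sub_const c
  obtain ⟨B, hB⟩ : ∃ B, ∀ n, |d n| ≤ B := by
    obtain ⟨B, hB⟩ := hd0.abs.bddAbove_range
    exact ⟨B, fun n => hB ⟨n, rfl⟩⟩
  have hvd (n : ℕ) : |v n * d n| ≤ B := by
    rw [abs_mul]
    nlinarith [hv1 n, hB n, abs_nonneg (d n), abs_nonneg (v n)]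
  have key : Tendsto (fun l => √l * poissonMix (fun n => v n * d n) l) atTop (nhds 0) := by
    rw [Metric.tendsto_atTop]
    intro e he
    obtain ⟨N, hN⟩ := (Metric.tendsto_atTop.1 hd0) (e / 4) (by positivity)
    have hfin : Tendsto (fun l => ∑ n ∈ Finset.range N, √l * poissonWeight l n * B) atTop
        (nhds 0) := by
      simpa using tendsto_finsetSum (Finset.range N) fun n _ =>
        (tendsto_sqrt_mul_poissonWeight n).mul_const B
    -- The terms below `N` contribute less than `e / 2`. The remaining ones have `|d n| < e / 4` and
    -- total weight below `2`.
    have e1 := hfin.eventually (gt_mem_nhds (show (0 : ℝ) < e / 2 by positivity))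
    have e2 := tendsto_sqrt_mul_poissonMix_inv_sqrt.eventually
      (gt_mem_nhds (show (1 : ℝ) < 2 by norm_num))
    obtain ⟨M, hM⟩ := eventually_atTop.1 (e1.and (e2.and (eventually_ge_atTop 0)))
    refine ⟨M, fun l hl => ?_⟩
    obtain ⟨h1, h2, hl0⟩ := hM l hl
    have hB0 : 0 ≤ B := (abs_nonneg _).trans (hB 0)
    have s1 : HasSum (fun n => if n ∈ Finset.range N then poissonWeight l n * B else 0)
        (∑ n ∈ Finset.range N, poissonWeight l n * B) := by
      rw [← Finset.sum_congr rfl fun n hn => if_pos hn]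
      exact hasSum_sum_of_ne_finset_zero fun n hn => if_neg hn
    have s2 := ((summable_poissonWeight_mul hl0 hv1).hasSum).mul_right (e / 4)
    have hbd : |poissonMix (fun n => v n * d n) l| ≤
        (∑ n ∈ Finset.range N, poissonWeight l n * B) + poissonMix v l * (e / 4) := by
      rw [← Real.norm_eq_abs, poissonMix]
      refine tsum_of_norm_bounded (s1.add s2) fun n => ?_
      have hw := poissonWeight_nonneg hl0 n
      rw [norm_mul, Real.norm_of_nonneg hw]
      split_ifs with hn
      · have : 0 ≤ poissonWeight l n * v n * (e / 4) := by
          have := hv0 n; positivity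
        have := mul_le_mul_of_nonneg_left (hvd n) hw
        rw [Real.norm_eq_abs]; linarith
      · have hdn := hN n (by simpa using hn)
        rw [Real.dist_eq, sub_zero] at hdn
        rw [zero_add, mul_assoc, Real.norm_eq_abs, abs_mul, abs_of_nonneg (hv0 n)]
        exact mul_le_mul_of_nonneg_left (mul_le_mul_of_nonneg_left hdn.le (hv0 n)) hw
    rw [Real.dist_eq, sub_zero, abs_mul, abs_of_nonneg (Real.sqrt_nonneg l)]
    calc _ ≤ √l * ((∑ n ∈ Finset.range N, poissonWeight l n * B) + poissonMix v l * (e / 4)) :=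
          mul_le_mul_of_nonneg_left hbd (Real.sqrt_nonneg l)
      _ = (∑ n ∈ Finset.range N, √l * poissonWeight l n * B) +
          (√l * poissonMix v l) * (e / 4) := by
        rw [mul_add, Finset.mul_sum]; simp only [mul_assoc]
      _ < e := by nlinarith
  have := (tendsto_sqrt_mul_poissonMix_inv_sqrt.mul_const c).add key
  rw [one_mul, add_zero] at this
  refine this.congr' ?_
  filter_upwards [eventually_ge_atTop 0] with l hl
  have h := ((summable_poissonWeight_mul hl hv1).hasSum.mul_right c).add
    (summable_poissonWeight_mul hl hvd).hasSum
  have h' : poissonMix q l = poissonMix v l * c + poissonMix (fun n => v n * d n) l := by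
    refine (tsum_congr fun n => ?_).trans h.tsum_eq
    rw [hqd n]; ring
  rw [h']; ring

/-! ### The embedded simple random walk -/

/-- Arithmetic mean over the two neighbours of a point of `ℤ`. -/
noncomputable def neighbourMean (f : ℤ → ℝ) (x : ℤ) : ℝ := (f (x + 1) + f (x - 1)) / 2

/-- The probability that the discrete simple random walk started at `x` visits `y` at one of the
times `0, …, n`, without a previous visit to `z`. -/
noncomputable def hitProb (y z : ℤ) : ℕ → ℤ → ℝ
  | 0, x => if x = y then 1 else 0
  | n + 1, x => if x = y then 1 else if x = z then 0 else neighbourMean (hitProb y z n) x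

/-- The probability that the discrete simple random walk started at `x` visits `y` at one of the
times `1, …, n`, without a previous visit to `z` at a positive time. -/
noncomputable def returnProb (y z : ℤ) : ℕ → ℤ → ℝ
  | 0, _ => 0
  | n + 1, x => neighbourMean (hitProb y z n) x

/-- The probability that the one-dimensional simple random walk does not move up by `d` in `n`
steps. -/
noncomputable def survival : ℕ → ℤ → ℝ
  | 0, d => if 0 < d then 1 else 0
  | n + 1, d => if 0 < d then neighbourMean (survival n) d else 0

lemma hitProb_self (y z : ℤ) (n : ℕ) : hitProb y z n y = 1 := by
  cases n <;> simp [hitProb]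

lemma hitProb_taboo {y z : ℤ} (h : y ≠ z) (n : ℕ) : hitProb y z n z = 0 := by
  cases n <;> simp [hitProb, h.symm]

lemma hitProb_mem_Icc (y z : ℤ) (n : ℕ) (x : ℤ) : hitProb y z n x ∈ Set.Icc (0 : ℝ) 1 := by
  induction n generalizing x with
  | zero => unfold hitProb; split_ifs <;> simp
  | succ n ih =>
    unfold hitProb neighbourMean
    obtain ⟨h1, h2⟩ := ih (x + 1)
    obtain ⟨h3, h4⟩ := ih (x - 1)
    split_ifs
    · simp
    · simp
    · constructor <;> linarith

lemma returnProb_mem_Icc (y z : ℤ) (n : ℕ) (x : ℤ) : returnProb y z n x ∈ Set.Icc (0 : ℝ) 1 := by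
  cases n with
  | zero => simp [returnProb]
  | succ n =>
    obtain ⟨h1, h2⟩ := hitProb_mem_Icc y z n (x + 1)
    obtain ⟨h3, h4⟩ := hitProb_mem_Icc y z n (x - 1)
    unfold returnProb neighbourMean
    constructor <;> linarith

lemma returnProb_eq_hitProb {y z x : ℤ} (hy : x ≠ y) (hz : x ≠ z) (n : ℕ) :
    returnProb y z n x = hitProb y z n x := by
  cases n <;> simp [returnProb, hitProb, hy, hz]

lemma hitProb_neg (y z : ℤ) (n : ℕ) (x : ℤ) :
    hitProb (-y) (-z) n (-x) = hitProb y z n x := by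
  induction n generalizing x with
  | zero => simp [hitProb]
  | succ n ih =>
    simp only [hitProb, neg_inj, neighbourMean]
    rw [← ih (x + 1), ← ih (x - 1), show -(x + 1) = -x - 1 by ring,
      show -(x - 1) = -x + 1 by ring, add_comm]

lemma returnProb_neg (y z : ℤ) (n : ℕ) (x : ℤ) :
    returnProb (-y) (-z) n (-x) = returnProb y z n x := by
  cases n with
  | zero => rfl
  | succ n =>
    simp only [returnProb, neighbourMean]
    rw [← hitProb_neg y z n (x + 1), ← hitProb_neg y z n (x - 1),
      show -(x + 1) = -x - 1 by ring, show -(x - 1) = -x + 1 by ring, add_comm]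

lemma survival_zero_right (n : ℕ) : survival n 0 = 0 := by
  cases n <;> simp [survival]

/-- A nearest-neighbour path from below must pass `y` before `z`, so the taboo plays no role. -/
lemma hitProb_eq_one_sub_survival {y z : ℤ} (h : y < z) (n : ℕ) {x : ℤ} (hx : x ≤ y) :
    hitProb y z n x = 1 - survival n (y - x) := by
  induction n generalizing x with
  | zero =>
    rcases hx.eq_or_lt with rfl | hx
    · simp [hitProb, survival]
    · simp [hitProb, survival, hx, hx.ne]
  | succ n ih =>
    rcases hx.eq_or_lt with rfl | hx
    · simp [hitProb, survival]
    · have h1 : x ≠ z := by omega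
      simp only [hitProb, survival, hx.ne, h1, if_false, sub_pos, hx, if_true, neighbourMean]
      rw [ih (by omega), ih (by omega), show y - (x + 1) = y - x - 1 by ring,
        show y - (x - 1) = y - x + 1 by ring]
      ring

lemma hitProb_eq_zero {y z : ℤ} (h : y < z) (n : ℕ) {x : ℤ} (hx : z ≤ x) :
    hitProb y z n x = 0 := by
  induction n generalizing x with
  | zero => have : x ≠ y := by omega
            simp [hitProb, this]
  | succ n ih =>
    have : x ≠ y := by omega
    simp only [hitProb, this, if_false]
    split_ifs with hz
    · rfl
    · unfold neighbourMean
      rw [ih (by omega), ih (by omega)]; norm_num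

/-- Inside the interval the hitting probabilities converge geometrically to their limits, which
are the ruin probabilities. -/
lemma ruin_sub_hitProb_mem_Icc {y z : ℤ} (h : y < z) (n : ℕ) {x : ℤ} (hy : y ≤ x) (hz : x ≤ z) :
    ((z : ℝ) - x) / ((z : ℝ) - y) - hitProb y z n x ∈
      Set.Icc 0 ((1 - 1 / (2 * ((z : ℝ) - y) ^ 2)) ^ n * (((x : ℝ) - y) * (z - x))) := by
  have hL : (1 : ℝ) ≤ (z : ℝ) - y := by exact_mod_cast (show 1 ≤ z - y by omega)
  set L : ℝ := (z : ℝ) - y with hLdef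
  set r : ℝ := 1 - 1 / (2 * L ^ 2) with hr
  have hr0 : 0 ≤ r := by
    rw [hr, sub_nonneg, div_le_one (by positivity)]; nlinarith
  induction n generalizing x with
  | zero =>
    rcases hy.eq_or_lt with rfl | hy
    · rw [hitProb_self, ← hLdef, div_self (by linarith)]; simp
    · have hx1 : (1 : ℝ) ≤ (x : ℝ) - y := by exact_mod_cast (show 1 ≤ x - y by omega)
      have hx2 : (0 : ℝ) ≤ (z : ℝ) - x := by exact_mod_cast (show 0 ≤ z - x by omega)
      rw [hitProb, if_neg (by omega), sub_zero, pow_zero, one_mul]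
      refine ⟨by positivity, ?_⟩
      calc ((z : ℝ) - x) / L ≤ (z : ℝ) - x := div_le_self hx2 hL
        _ ≤ _ := by nlinarith
  | succ n ih =>
    rcases hy.eq_or_lt with rfl | hy
    · rw [hitProb_self, ← hLdef, div_self (by linarith)]; simp
    rcases hz.eq_or_lt with rfl | hz
    · rw [hitProb_taboo (by omega)]; simp
    obtain ⟨a1, a2⟩ := ih (x := x + 1) (by omega) (by omega)
    obtain ⟨b1, b2⟩ := ih (x := x - 1) (by omega) (by omega)
    have hx1 : (1 : ℝ) ≤ (x : ℝ) - y := by exact_mod_cast (show 1 ≤ x - y by omega)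
    have hx2 : (1 : ℝ) ≤ (z : ℝ) - x := by exact_mod_cast (show 1 ≤ z - x by omega)
    push_cast at a1 a2 b1 b2
    rw [hitProb, if_neg (by omega), if_neg (by omega), neighbourMean]
    -- The ruin probability is affine, hence harmonic, so the error obeys the same averaging
    -- recursion.
    have e1 : ((z : ℝ) - x) / L - (hitProb y z n (x + 1) + hitProb y z n (x - 1)) / 2 =
        ((((z : ℝ) - (x + 1)) / L - hitProb y z n (x + 1)) +
          (((z : ℝ) - (x - 1)) / L - hitProb y z n (x - 1))) / 2 := by ring
    rw [e1]
    refine ⟨by linarith, ?_⟩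
    have hp : 0 ≤ r ^ n := by positivity
    -- Averaging lowers the quadratic `(x - y) * (z - x)` by exactly `1`. Since it is at most `2 * L
    -- ^ 2`, this is at least the loss caused by the factor `r`.
    have e2 : (((x : ℝ) + 1 - y) * (z - (x + 1)) + ((x : ℝ) - 1 - y) * (z - (x - 1))) / 2 ≤
        r * (((x : ℝ) - y) * (z - x)) := by
      have : 1 / (2 * L ^ 2) * (((x : ℝ) - y) * (z - x)) ≤ 1 := by
        rw [div_mul_eq_mul_div, one_mul, div_le_one (by positivity)]
        nlinarith
      rw [hr]; nlinarith
    calc _ ≤ r ^ n * ((((x : ℝ) + 1 - y) * (z - (x + 1)) +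
          ((x : ℝ) - 1 - y) * (z - (x - 1))) / 2) := by linarith
      _ ≤ r ^ n * (r * (((x : ℝ) - y) * (z - x))) := mul_le_mul_of_nonneg_left e2 hp
      _ = _ := by ring

/-! ### Survival probabilities of the half-line -/

/-- `P(X n < m)` for the simple random walk `X` started at `0`. -/
noncomputable def walkCDF : ℕ → ℤ → ℝ
  | 0, m => if 0 < m then 1 else 0
  | n + 1, m => neighbourMean (walkCDF n) m

/-- The reflection principle. -/
lemma survival_eq (n : ℕ) {d : ℤ} (hd : 0 ≤ d) :
    survival n d = walkCDF n d - walkCDF n (-d) := by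
  -- The right-hand side is odd in `d`, so it vanishes at `0` where the walk is killed, and it
  -- satisfies the free averaging recursion elsewhere.
  induction n generalizing d with
  | zero => rcases hd.eq_or_lt with rfl | hd
            · simp [survival]
            · have : ¬ (d < 0) := by omega
              simp [survival, walkCDF, hd, this]
  | succ n ih =>
    rcases hd.eq_or_lt with rfl | hd
    · simp [survival]
    · simp only [survival, walkCDF, hd, if_true, neighbourMean]
      rw [ih (by omega), ih (by omega), show -(d + 1) = -d - 1 by ring,
        show -(d - 1) = -d + 1 by ring]
      ring

/-- After `n` steps the walk sits at `2 * i - n` with binomial probability (Pascal's rule), never at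
points of the other parity, and never below `-n`. The last clause supplies the boundary case `i = 0`
of the induction. -/
lemma walkCDF_jump (n : ℕ) :
    (∀ i : ℕ, walkCDF n (2 * i - n + 1) - walkCDF n (2 * i - n) = n.choose i / 2 ^ n) ∧
    (∀ i : ℕ, walkCDF n (2 * i - n) - walkCDF n (2 * i - n - 1) = 0) ∧
    (∀ m : ℤ, m ≤ -n → walkCDF n m = 0) := by
  induction n with
  | zero =>
    refine ⟨fun i => ?_, fun i => ?_, fun m hm => ?_⟩
    · rcases i with _ | i
      · simp [walkCDF]
      · simp [walkCDF]
        rw [if_pos (by omega), sub_self]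
    · rcases i with _ | i
      · simp [walkCDF]
      · simp [walkCDF]
        rw [if_pos (by omega), sub_self]
    · simp at hm
      simp [walkCDF, hm]
  | succ n ih =>
    obtain ⟨h1, h2, h3⟩ := ih
    refine ⟨fun i => ?_, fun i => ?_, fun m hm => ?_⟩
    · rcases i with _ | i
      · have e1 := h1 0
        simp only [walkCDF, neighbourMean, Nat.cast_add, Nat.cast_one]
        rw [h3 (2 * ((0 : ℕ) : ℤ) - (n + 1) - 1) (by push_cast; omega),
          h3 (2 * ((0 : ℕ) : ℤ) - (n + 1) + 1 - 1) (by push_cast; omega)]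
        rw [h3 (2 * ((0 : ℕ) : ℤ) - n) (by push_cast; omega)] at e1
        rw [h3 (2 * ((0 : ℕ) : ℤ) - (n + 1) + 1) (by push_cast; omega)]
        rw [show (2 * ((0 : ℕ) : ℤ) - (n + 1) + 1 + 1) = 2 * ((0 : ℕ) : ℤ) - n + 1 by ring]
        simp only [Nat.choose_zero_right] at e1 ⊢
        rw [pow_succ]
        field_simp at e1 ⊢
        linarith
      · have e1 := h1 (i + 1)
        have e2 := h1 i
        simp only [walkCDF, neighbourMean]
        rw [Nat.choose_succ_succ, pow_succ]
        push_cast at e1 e2 ⊢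
        rw [show 2 * ((i : ℤ) + 1) - (n + 1) + 1 + 1 = 2 * (i + 1) - n + 1 by ring,
          show 2 * ((i : ℤ) + 1) - (n + 1) + 1 - 1 = 2 * i - n + 1 by ring,
          show 2 * ((i : ℤ) + 1) - (n + 1) + 1 = 2 * (i + 1) - n by ring,
          show 2 * ((i : ℤ) + 1) - (n + 1) - 1 = 2 * i - n by ring]
        have : ((n.choose i : ℝ) + n.choose (i + 1)) / (2 ^ n * 2) =
            (n.choose i / 2 ^ n + n.choose (i + 1) / 2 ^ n) / 2 := by field_simp
        rw [this, ← e1, ← e2]; ring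
    · have e1 := h2 i
      simp only [walkCDF, neighbourMean]
      push_cast
      rcases i with _ | i
      · rw [h3 _ (by push_cast; omega), h3 _ (by push_cast; omega), h3 _ (by push_cast; omega),
          h3 _ (by push_cast; omega)]; norm_num
      · have e2 := h2 i
        push_cast at e1 e2 ⊢
        rw [show 2 * ((i : ℤ) + 1) - (n + 1) + 1 = 2 * (i + 1) - n by ring,
          show 2 * ((i : ℤ) + 1) - (n + 1) - 1 + 1 = 2 * (i + 1) - n - 1 by ring,
          show 2 * ((i : ℤ) + 1) - (n + 1) - 1 = 2 * i - n by ring,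
          show 2 * (i : ℤ) - n - 1 = 2 * i - n - 1 by ring]
        linarith
    · simp only [walkCDF, neighbourMean]
      push_cast at hm
      rw [h3 _ (by omega), h3 _ (by omega)]; norm_num

/-- By reflection, `survival n 1` is the probability of being at `-1` or `0` after `n` steps. Parity
leaves only `0` here, and only `-1` for odd `n`. -/
lemma survival_two_mul (m : ℕ) : survival (2 * m) 1 = m.centralBinom / 4 ^ m := by
  have h1 := (walkCDF_jump (2 * m)).1 m
  have h2 := (walkCDF_jump (2 * m)).2.1 m
  push_cast at h1 h2
  simp only [sub_self, zero_add, zero_sub] at h1 h2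
  rw [survival_eq _ (by norm_num), Nat.centralBinom, show (4 : ℝ) = 2 ^ 2 by norm_num,
    ← pow_mul, ← h1]
  linarith

lemma survival_two_mul_add_one (m : ℕ) :
    survival (2 * m + 1) 1 = (m + 1).centralBinom / 4 ^ (m + 1) := by
  have h1 := (walkCDF_jump (2 * m + 1)).1 m
  have h2 := (walkCDF_jump (2 * m + 1)).2.1 (m + 1)
  push_cast at h1 h2
  rw [show 2 * (m : ℤ) - (2 * m + 1) = -1 by ring] at h1
  rw [show 2 * ((m : ℤ) + 1) - (2 * m + 1) = 1 by ring] at h2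
  norm_num at h1 h2
  rw [survival_eq _ (by norm_num), show (4 : ℝ) = 2 ^ 2 by norm_num,
    ← pow_mul, Nat.centralBinom, show 2 * (m + 1) = 2 * m + 1 + 1 by ring,
    Nat.choose_succ_succ, ← Nat.choose_symm_half m, pow_succ]
  push_cast
  rw [show ((2 * m + 1).choose (m + 1) + (2 * m + 1).choose (m + 1) : ℝ) / (2 ^ (2 * m + 1) * 2)
    = (2 * m + 1).choose (m + 1) / 2 ^ (2 * m + 1) by field_simp; ring]
  rw [Nat.choose_symm_half, ← h1]
  linarith

/-- The ratio of consecutive values of `centralBinom / 4 ^ m` is `(2 * m + 1) / (2 * m + 2)`, so its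
square, with the factor `2 * m + 1`, telescopes against Wallis' product. -/
lemma wallis_eq_centralBinom (m : ℕ) :
    Real.Wallis.W m * ((2 * m + 1) * (m.centralBinom / 4 ^ m : ℝ) ^ 2) = 1 := by
  induction m with
  | zero => simp [Real.Wallis.W]
  | succ m ih =>
    have h : ((m + 1).centralBinom / 4 ^ (m + 1) : ℝ) =
        (m.centralBinom / 4 ^ m) * ((2 * m + 1) / (2 * m + 2)) := by
      have := Nat.succ_mul_centralBinom_succ m
      have h' : ((m : ℝ) + 1) * (m + 1).centralBinom = 2 * (2 * m + 1) * m.centralBinom := by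
        exact_mod_cast this
      rw [pow_succ]
      field_simp
      linarith
    rw [Real.Wallis.W_succ, h]
    refine Eq.trans ?_ ih
    push_cast
    field_simp
    ring

lemma tendsto_sqrt_mul_centralBinom :
    Tendsto (fun m : ℕ => √(2 * m + 1) * (m.centralBinom / 4 ^ m : ℝ)) atTop
      (nhds √(2 / Real.pi)) := by
  have h := (Real.Wallis.tendsto_W_nhds_pi_div_two.inv₀ (by positivity)).sqrt
  rw [inv_div] at h
  refine h.congr fun m => ?_
  rw [← eq_inv_of_mul_eq_one_right (wallis_eq_centralBinom m), Real.sqrt_mul (by positivity),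
    Real.sqrt_sq (by positivity)]

lemma tendsto_of_even_of_odd {f : ℕ → ℝ} {l : Filter ℝ} (h0 : Tendsto (fun m => f (2 * m)) atTop l)
    (h1 : Tendsto (fun m => f (2 * m + 1)) atTop l) : Tendsto f atTop l := by
  intro s hs
  obtain ⟨N0, hN0⟩ := eventually_atTop.1 (h0.eventually hs)
  obtain ⟨N1, hN1⟩ := eventually_atTop.1 (h1.eventually hs)
  refine eventually_atTop.2 ⟨2 * N0 + 2 * N1 + 1, fun n hn => ?_⟩
  rcases Nat.even_or_odd' n with ⟨m, rfl | rfl⟩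
  · exact hN0 m (by omega)
  · exact hN1 m (by omega)

lemma tendsto_sqrt_add_one_div : Tendsto (fun n : ℕ => √(((n : ℝ) + 1) / (n + 1 + 1)))
    atTop (nhds 1) := by
  have := (tendsto_natCast_div_add_atTop (𝕜 := ℝ) 1).comp (tendsto_add_atTop_nat 1)
  simpa using this.sqrt

lemma tendsto_sqrt_mul_survival_one :
    Tendsto (fun n : ℕ => √((n : ℝ) + 1) * survival n 1) atTop (nhds √(2 / Real.pi)) := by
  refine tendsto_of_even_of_odd ?_ ?_
  · simpa [survival_two_mul] using tendsto_sqrt_mul_centralBinom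
  · have h1 := tendsto_sqrt_mul_centralBinom.comp (tendsto_add_atTop_nat 1)
    -- The odd value is the central binomial term of index `m + 1`, so `√(2 * m + 2)` has to be
    -- traded for `√(2 * m + 3)`.
    have h2 := tendsto_sqrt_add_one_div.comp
      (tendsto_atTop_mono (fun m => show m ≤ 2 * m + 1 by omega) tendsto_id)
    have h3 := h2.mul h1
    rw [one_mul] at h3
    refine h3.congr fun m => ?_
    simp only [Function.comp_apply, survival_two_mul_add_one]
    push_cast
    rw [← mul_assoc, ← Real.sqrt_mul (by positivity)]
    congr 2
    field_simp
    ring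

/-- The survival probability of the walk below level `d` is asymptotic to `d √(2 / (π n))`. -/
theorem tendsto_sqrt_mul_survival (d : ℕ) :
    Tendsto (fun n : ℕ => √((n : ℝ) + 1) * survival n d) atTop (nhds (d * √(2 / Real.pi))) := by
  induction d using Nat.strong_induction_on with
  | _ d ih =>
    match d with
    | 0 => simp [survival_zero_right]
    | 1 => simpa using tendsto_sqrt_mul_survival_one
    | d + 2 =>
      -- Read the recursion at level `d + 1` backwards: `survival n (d + 2) = 2 * survival (n + 1)
      -- (d + 1) - survival n d`. The limits are therefore linear in `d`.
      have h1 := (tendsto_sqrt_add_one_div.mul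
        ((ih (d + 1) (by omega)).comp (tendsto_add_atTop_nat 1))).const_mul 2
      have h2 := h1.sub (ih d (by omega))
      have e : 2 * (1 * (((d + 1 : ℕ) : ℝ) * √(2 / Real.pi))) - d * √(2 / Real.pi) =
          ((d + 2 : ℕ) : ℝ) * √(2 / Real.pi) := by push_cast; ring
      rw [e] at h2
      refine h2.congr fun n => ?_
      simp only [Function.comp_apply]
      push_cast
      rw [← mul_assoc (√_) (√_), ← Real.sqrt_mul (by positivity),
        div_mul_cancel₀ _ (by positivity)]
      simp only [survival, neighbourMean]
      rw [if_pos (by positivity), show (d : ℤ) + 1 + 1 = d + 2 by ring,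
        show (d : ℤ) + 1 - 1 = d by ring]
      ring

/-! ### Jump times -/

lemma lintegral_expMeasure {a : ℝ} {f : ℝ → ℝ≥0∞} (hf : Measurable f) :
    ∫⁻ x, f x ∂(expMeasure a) = ∫⁻ x, exponentialPDF a x * f x := by
  have hm : Measurable (gammaPDF 1 a) := (measurable_gammaPDFReal 1 a).ennreal_ofReal
  rw [expMeasure, gammaMeasure, lintegral_withDensity_eq_lintegral_mul _ hm hf]
  rfl

/-- In the convolution integrand `exp (-a x) * exp (-a (t - x))` is the constant `exp (-a t)`, so
beside one exponential only a polynomial in `t - x` has to be integrated. -/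
lemma hasDerivAt_erlang (a t : ℝ) (n : ℕ) (x : ℝ) :
    HasDerivAt (fun x => -Real.exp (-(a * x)) +
        Real.exp (-(a * t)) * ∑ j ∈ Finset.range n, (a * (t - x)) ^ (j + 1) / (j + 1).factorial)
      (a * Real.exp (-(a * x)) *
        (1 - ∑ j ∈ Finset.range n, poissonWeight (a * (t - x)) j)) x := by
  have h1 : HasDerivAt (fun x : ℝ => a * (t - x)) (-a) x := by
    simpa using ((hasDerivAt_id x).const_sub t).const_mul a
  have h2 : HasDerivAt (fun x => ∑ j ∈ Finset.range n,
      (a * (t - x)) ^ (j + 1) / ((j + 1).factorial : ℝ))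
      (∑ j ∈ Finset.range n, (-a) * ((a * (t - x)) ^ j / (j.factorial : ℝ))) x := by
    refine HasDerivAt.fun_sum fun j _ => ?_
    refine ((h1.pow (j + 1)).div_const _).congr_deriv ?_
    rw [Nat.factorial_succ]
    push_cast
    have : (j.factorial : ℝ) ≠ 0 := by positivity
    field_simp
  have h3 : HasDerivAt (fun x => -Real.exp (-(a * x))) (a * Real.exp (-(a * x))) x :=
    hasDerivAt_neg_exp_mul_exp
  refine (h3.add (h2.const_mul (Real.exp (-(a * t))))).congr_deriv ?_
  rw [mul_sub (a * _), mul_one, sub_eq_add_neg (a * _), Finset.mul_sum, Finset.mul_sum,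
    ← Finset.sum_neg_distrib]
  congr 1
  refine Finset.sum_congr rfl fun j _ => ?_
  have : Real.exp (-(a * t)) = Real.exp (-(a * x)) * Real.exp (-(a * (t - x))) := by
    rw [← Real.exp_add]; ring_nf
  rw [poissonWeight, this]; ring

lemma continuous_poissonWeight (n : ℕ) : Continuous fun l => poissonWeight l n := by
  unfold poissonWeight; fun_prop

lemma integral_exp_mul_erlang (a t : ℝ) (n : ℕ) :
    ∫ x in (0 : ℝ)..t, a * Real.exp (-(a * x)) *
        (1 - ∑ j ∈ Finset.range n, poissonWeight (a * (t - x)) j) =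
      1 - ∑ j ∈ Finset.range (n + 1), poissonWeight (a * t) j := by
  rw [intervalIntegral.integral_eq_sub_of_hasDerivAt (fun x _ => hasDerivAt_erlang a t n x)]
  · rw [Finset.sum_range_succ']
    simp only [sub_self, mul_zero, sub_zero, neg_zero, Real.exp_zero]
    simp [poissonWeight, Finset.mul_sum, mul_div_assoc]
    ring
  · refine Continuous.intervalIntegrable ?_ _ _
    have (j : ℕ) : Continuous fun x => poissonWeight (a * (t - x)) j :=
      (continuous_poissonWeight j).comp (by fun_prop)
    fun_prop

lemma sum_poissonWeight_le_one {l : ℝ} (hl : 0 ≤ l) (n : ℕ) :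
    ∑ j ∈ Finset.range n, poissonWeight l j ≤ 1 :=
  sum_le_hasSum _ (fun j _ => poissonWeight_nonneg hl j) (hasSum_poissonWeight l)

/-- Convolution with an exponential law sends an Erlang law to the next one. -/
lemma expMeasure_conv_Iic {a : ℝ} (ha : 0 < a) {μ : Measure ℝ} [IsProbabilityMeasure μ] {n : ℕ}
    (h0 : ∀ t < 0, μ (Set.Iic t) = 0)
    (h1 : ∀ t, 0 ≤ t → μ (Set.Iic t) =
      ENNReal.ofReal (1 - ∑ j ∈ Finset.range n, poissonWeight (a * t) j)) :
    (∀ t < 0, (expMeasure a ∗ μ) (Set.Iic t) = 0) ∧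
    ∀ t, 0 ≤ t → (expMeasure a ∗ μ) (Set.Iic t) =
      ENNReal.ofReal (1 - ∑ j ∈ Finset.range (n + 1), poissonWeight (a * t) j) := by
  have hconv (t : ℝ) : (expMeasure a ∗ μ) (Set.Iic t) =
      ∫⁻ x, exponentialPDF a x * μ (Set.Iic (t - x)) := by
    rw [← lintegral_indicator_one measurableSet_Iic,
      Measure.lintegral_conv (measurable_one.indicator measurableSet_Iic)]
    have e (x : ℝ) : ∫⁻ y, (Set.Iic t).indicator 1 (x + y) ∂μ = μ (Set.Iic (t - x)) := by
      rw [← lintegral_indicator_one measurableSet_Iic]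
      refine lintegral_congr fun y => ?_
      simp [Set.indicator_apply, le_sub_iff_add_le, add_comm]
    simp only [e]
    refine lintegral_expMeasure ?_
    have : Antitone fun x : ℝ => μ (Set.Iic (t - x)) := fun x y hxy =>
      measure_mono (Set.Iic_subset_Iic.2 (by linarith))
    exact this.measurable
  refine ⟨fun t ht => ?_, fun t ht => ?_⟩
  · rw [hconv]
    refine (lintegral_congr fun x => ?_).trans lintegral_zero
    rcases lt_or_ge x 0 with hx | hx
    · rw [exponentialPDF_of_neg hx, zero_mul]
    · rw [h0 _ (by linarith), mul_zero]
  · rw [hconv, ← integral_exp_mul_erlang, intervalIntegral.integral_of_le ht,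
      ← integral_Icc_eq_integral_Ioc, ofReal_integral_eq_lintegral_ofReal]
    · rw [← lintegral_indicator measurableSet_Icc]
      refine lintegral_congr fun x => ?_
      by_cases hx : x ∈ Set.Icc 0 t
      · rw [Set.indicator_of_mem hx, exponentialPDF_of_nonneg hx.1, h1 _ (by linarith [hx.2]),
          ← ENNReal.ofReal_mul (by positivity)]
      · rw [Set.indicator_of_notMem hx]
        rcases lt_or_ge x 0 with hx0 | hx0
        · rw [exponentialPDF_of_neg hx0, zero_mul]
        · have : t < x := by by_contra! h; exact hx ⟨hx0, h⟩
          rw [h0 _ (by linarith), mul_zero]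
    · have (j : ℕ) : Continuous fun x => poissonWeight (a * (t - x)) j :=
        (continuous_poissonWeight j).comp (by fun_prop)
      exact Continuous.integrableOn_Icc (by fun_prop)
    · filter_upwards [ae_restrict_mem measurableSet_Icc] with x hx
      have := sum_poissonWeight_le_one (mul_nonneg ha.le (sub_nonneg.2 hx.2)) n
      have : 0 ≤ 1 - ∑ j ∈ Finset.range n, poissonWeight (a * (t - x)) j := by linarith
      simp only [Pi.zero_apply]
      positivity

lemma ae_pos_of_map_eq_expMeasure {Ω : Type*} [MeasurableSpace Ω] {P : Measure Ω} {a : ℝ}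
    {T : ℕ → Ω → ℝ} (ha : 0 < a) (hT : ∀ n, Measurable (T n))
    (hlaw : ∀ n, P.map (T n) = expMeasure a) : ∀ᵐ ω ∂P, ∀ n, 0 < T n ω := by
  rw [ae_all_iff]
  intro n
  have hp' := isProbabilityMeasure_expMeasure ha
  have h : P (T n ⁻¹' Set.Iic 0) = 0 := by
    rw [← Measure.map_apply (hT n) measurableSet_Iic, hlaw, ← measureReal_eq_zero_iff,
      ← cdf_eq_real, cdf_expMeasure_eq ha]
    simp
  rw [ae_iff]
  convert h using 2
  ext ω; simp

lemma measurable_sum_range {Ω : Type*} [MeasurableSpace Ω] {T : ℕ → Ω → ℝ}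
    (hT : ∀ n, Measurable (T n)) (n : ℕ) : Measurable (∑ i ∈ Finset.range n, T i) := by
  convert! Finset.measurable_sum (Finset.range n) fun i _ => hT i
  simp

section JumpTimes

variable {Ω : Type*} [MeasurableSpace Ω] {P : Measure Ω} [IsProbabilityMeasure P] {a : ℝ}
  {T : ℕ → Ω → ℝ}

/-- Erlang laws by repeated convolution, starting from the Dirac mass at `0`. The clause for `t < 0`
is carried along because it confines the convolution integral to `[0, t]`. -/
lemma map_sum_Iic (ha : 0 < a) (hT : ∀ n, Measurable (T n))
    (hlaw : ∀ n, P.map (T n) = expMeasure a) (hind : iIndepFun T P) (n : ℕ) :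
    (∀ t < 0, P.map (∑ i ∈ Finset.range n, T i) (Set.Iic t) = 0) ∧
    ∀ t, 0 ≤ t → P.map (∑ i ∈ Finset.range n, T i) (Set.Iic t) =
      ENNReal.ofReal (1 - ∑ j ∈ Finset.range n, poissonWeight (a * t) j) := by
  induction n with
  | zero =>
    have h : P.map (∑ i ∈ Finset.range 0, T i) = Measure.dirac 0 := by
      rw [Finset.range_zero, Finset.sum_empty]
      exact (Measure.map_const P 0).trans (by simp)
    rw [h]
    constructor <;> intro t ht
    · rw [Measure.dirac_apply' _ measurableSet_Iic]; simpa using ht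
    · rw [Measure.dirac_apply' _ measurableSet_Iic, Set.indicator_of_mem (by simpa using ht)]
      simp
  | succ n ih =>
    have hs : Measurable (∑ i ∈ Finset.range n, T i) :=
      measurable_sum_range hT n
    have hp : IsProbabilityMeasure (P.map (∑ i ∈ Finset.range n, T i)) :=
      Measure.isProbabilityMeasure_map hs.aemeasurable
    have hp' := isProbabilityMeasure_expMeasure ha
    rw [Finset.sum_range_succ,
      (hind.indepFun_sum_range_succ hT n).map_add_eq_map_conv_map hs (hT n), hlaw,
      Measure.conv_comm]
    exact expMeasure_conv_Iic ha ih.1 ih.2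

lemma measure_sum_le (ha : 0 < a) (hT : ∀ n, Measurable (T n))
    (hlaw : ∀ n, P.map (T n) = expMeasure a) (hind : iIndepFun T P) (n : ℕ) {t : ℝ}
    (ht : 0 ≤ t) : P {ω | ∑ i ∈ Finset.range n, T i ω ≤ t} =
      ENNReal.ofReal (1 - ∑ j ∈ Finset.range n, poissonWeight (a * t) j) := by
  rw [← (map_sum_Iic ha hT hlaw hind n).2 t ht, Measure.map_apply
    (measurable_sum_range hT n) measurableSet_Iic]
  congr 1
  ext ω
  simp

/-- No explosion: for each `n`, all sums staying below `k` is at most as likely as a Poisson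
variable being at least `n`, which tends to `0`. -/
lemma ae_unbounded_sum (ha : 0 < a) (hT : ∀ n, Measurable (T n))
    (hlaw : ∀ n, P.map (T n) = expMeasure a) (hind : iIndepFun T P) :
    ∀ᵐ ω ∂P, ∀ t : ℝ, ∃ n, t < ∑ i ∈ Finset.range n, T i ω := by
  have key : ∀ᵐ ω ∂P, ∀ k : ℕ, ∃ n, (k : ℝ) < ∑ i ∈ Finset.range n, T i ω := by
    rw [ae_all_iff]
    intro k
    rw [ae_iff]
    have h1 : Tendsto (fun n => ENNReal.ofReal
        (1 - ∑ j ∈ Finset.range n, poissonWeight (a * k) j)) atTop (nhds 0) := by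
      have := ((hasSum_poissonWeight (a * k)).tendsto_sum_nat).const_sub 1
      simpa using ENNReal.tendsto_ofReal this
    refine le_antisymm (ge_of_tendsto' h1 fun n => ?_) zero_le
    rw [← measure_sum_le ha hT hlaw hind n (Nat.cast_nonneg k)]
    refine measure_mono fun ω hω => ?_
    simp only [Set.mem_ofPred_eq, not_exists, not_lt] at hω
    exact hω n
  filter_upwards [key] with ω hω t
  obtain ⟨k, hk⟩ := exists_nat_gt t
  obtain ⟨n, hn⟩ := hω k
  exact ⟨n, hk.trans hn⟩

/-- The number of jumps up to time `t` has a Poisson distribution. -/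
lemma measure_jumpCount (ha : 0 < a) (hT : ∀ n, Measurable (T n))
    (hlaw : ∀ n, P.map (T n) = expMeasure a) (hind : iIndepFun T P) (n : ℕ) {t : ℝ}
    (ht : 0 ≤ t) :
    P {ω | ∑ i ∈ Finset.range n, T i ω ≤ t ∧ t < ∑ i ∈ Finset.range (n + 1), T i ω} =
      ENNReal.ofReal (poissonWeight (a * t) n) := by
  have hm (n : ℕ) : MeasurableSet {ω | ∑ i ∈ Finset.range n, T i ω ≤ t} :=
    measurableSet_le (Finset.measurable_sum _ fun i _ => hT i) measurable_const
  have hl : 0 ≤ a * t := by positivity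
  have hsub : {ω | ∑ i ∈ Finset.range (n + 1), T i ω ≤ t} ≤ᵐ[P]
      {ω | ∑ i ∈ Finset.range n, T i ω ≤ t} := by
    filter_upwards [ae_pos_of_map_eq_expMeasure ha hT hlaw] with ω hω h
    change ∑ i ∈ Finset.range (n + 1), T i ω ≤ t at h
    change ∑ i ∈ Finset.range n, T i ω ≤ t
    rw [Finset.sum_range_succ] at h
    linarith [hω n]
  have h := measure_sdiff' {ω | ∑ i ∈ Finset.range n, T i ω ≤ t} (hm (n + 1)).nullMeasurableSet
    (measure_ne_top P _)
  have hu : P ({ω | ∑ i ∈ Finset.range n, T i ω ≤ t} ∪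
      {ω | ∑ i ∈ Finset.range (n + 1), T i ω ≤ t}) =
      P {ω | ∑ i ∈ Finset.range n, T i ω ≤ t} := by
    refine measure_congr ?_
    exact union_ae_eq_left_iff_ae_subset.2 hsub
  rw [hu, measure_sum_le ha hT hlaw hind _ ht, measure_sum_le ha hT hlaw hind _ ht,
    ← ENNReal.ofReal_sub _ (by linarith [sum_poissonWeight_le_one hl (n + 1)]),
    Finset.sum_range_succ] at h
  convert h using 2
  · ext ω; simp
  · ring

end JumpTimes

/-! ### The embedded chain of the continuous-time walk -/

lemma embeddedProb_simpleGenerator {a : ℝ} (ha : 0 < a) (x y : ℤ) :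
    embeddedProb (simpleGenerator a) x y = if |y - x| = 1 then 1 / 2 else 0 := by
  have hj : jumpRate (simpleGenerator a) = a := by simp [jumpRate, simpleGenerator]
  unfold embeddedProb
  rw [hj]
  by_cases h : x = y
  · subst h; simp
  · rw [if_neg h, simpleGenerator, if_neg (Ne.symm h)]
    split_ifs
    · field_simp
    · simp

/-- The sequence `s` visits `y` at one of the times `m, …, n`, without a previous visit to `z`
from time `m` on. -/
def HitsBetween (y z : ℤ) (m n : ℕ) (s : ℕ → ℤ) : Prop :=
  ∃ k, m ≤ k ∧ k ≤ n ∧ s k = y ∧ ∀ j, m ≤ j → j ≤ k → s j ≠ z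

lemma measurableSet_hitsBetween (y z : ℤ) (m n : ℕ) :
    MeasurableSet {s : ℕ → ℤ | HitsBetween y z m n s} := by
  have h1 (k : ℕ) (v : ℤ) : Measurable fun s : ℕ → ℤ => s k = v :=
    measurableSet_setOfPred.1 (measurableSet_eq_fun (measurable_pi_apply k) measurable_const)
  refine measurableSet_setOfPred.2 (Measurable.exists fun k => ?_)
  refine measurable_const.and (measurable_const.and ((h1 k y).and ?_))
  exact Measurable.forall fun j => measurable_const.imp (measurable_const.imp (h1 j z).not)

lemma not_hitsBetween_of_lt {y z : ℤ} {m n : ℕ} (h : n < m) (s : ℕ → ℤ) :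
    ¬ HitsBetween y z m n s := by
  rintro ⟨k, h1, h2, -⟩
  omega

lemma hitsBetween_of_eq {y z : ℤ} (hyz : y ≠ z) {m n : ℕ} (h : m ≤ n) {s : ℕ → ℤ}
    (hs : s m = y) : HitsBetween y z m n s :=
  ⟨m, le_rfl, h, hs, fun j h1 h2 => by rwa [le_antisymm h2 h1, hs]⟩

lemma not_hitsBetween_of_eq {y z : ℤ} {m n : ℕ} {s : ℕ → ℤ}
    (hs : s m = z) : ¬ HitsBetween y z m n s := by
  rintro ⟨k, h1, -, -, h4⟩
  exact h4 m le_rfl h1 hs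

lemma hitsBetween_iff_succ {y z : ℤ} {m n : ℕ} {s : ℕ → ℤ}
    (hy : s m ≠ y) (hz : s m ≠ z) : HitsBetween y z m n s ↔ HitsBetween y z (m + 1) n s := by
  constructor
  · rintro ⟨k, h1, h2, h3, h4⟩
    have : k ≠ m := by rintro rfl; exact hy h3
    exact ⟨k, by omega, h2, h3, fun j hj => h4 j (by omega)⟩
  · rintro ⟨k, h1, h2, h3, h4⟩
    refine ⟨k, by omega, h2, h3, fun j hj hjk => ?_⟩
    rcases hj.eq_or_lt with rfl | hj
    · exact hz
    · exact h4 j hj hjk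

section Chain

variable {Ω : Type*} [MeasurableSpace Ω] {P : Measure Ω} {Y : ℕ → Ω → ℤ}

lemma measurableSet_prefix (hY : ∀ n, Measurable (Y n)) (m : ℕ) (s : ℕ → ℤ) :
    MeasurableSet {ω | ∀ i ≤ m, Y i ω = s i} := by
  have h1 (k : ℕ) (v : ℤ) : Measurable fun ω => Y k ω = v :=
    measurableSet_setOfPred.1 (measurableSet_eq_fun (hY k) measurable_const)
  exact measurableSet_setOfPred.2
    (Measurable.forall fun j => measurable_const.imp (h1 j _))

lemma measurableSet_hitsBetween_comp (hY : ∀ n, Measurable (Y n)) (y z : ℤ) (m n : ℕ) :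
    MeasurableSet {ω | HitsBetween y z m n fun i => Y i ω} :=
  measurable_pi_lambda (fun ω i => Y i ω) hY (measurableSet_hitsBetween y z m n)

/-- Conditioning on the next step of the chain. -/
lemma measure_prefix_inter_of_step (hY : ∀ n, Measurable (Y n))
    (hstep : ∀ (m : ℕ) (s : ℕ → ℤ), P {ω | ∀ i ≤ m + 1, Y i ω = s i} =
      P {ω | ∀ i ≤ m, Y i ω = s i} *
        ENNReal.ofReal (if |s (m + 1) - s m| = 1 then 1 / 2 else 0))
    {m : ℕ} {s : ℕ → ℤ} {B : Set Ω} (hB : MeasurableSet B) {f : ℤ → ℝ} (hf : ∀ v, 0 ≤ f v)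
    (h : ∀ v, P ({ω | ∀ i ≤ m + 1, Y i ω = Function.update s (m + 1) v i} ∩ B) =
      P {ω | ∀ i ≤ m + 1, Y i ω = Function.update s (m + 1) v i} * ENNReal.ofReal (f v)) :
    P ({ω | ∀ i ≤ m, Y i ω = s i} ∩ B) =
      P {ω | ∀ i ≤ m, Y i ω = s i} * ENNReal.ofReal (neighbourMean f (s m)) := by
  have hpre (v : ℤ) : {ω | ∀ i ≤ m + 1, Y i ω = Function.update s (m + 1) v i} =
      {ω | ∀ i ≤ m, Y i ω = s i} ∩ Y (m + 1) ⁻¹' {v} := by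
    ext ω
    change (∀ i ≤ m + 1, Y i ω = Function.update s (m + 1) v i) ↔
      (∀ i ≤ m, Y i ω = s i) ∧ Y (m + 1) ω = v
    constructor
    · intro h
      refine ⟨fun i hi => ?_, ?_⟩
      · rw [h i (by omega), Function.update_of_ne (by omega)]
      · rw [h _ le_rfl, Function.update_self]
    · rintro ⟨h1, h2⟩ i hi
      rcases eq_or_ne i (m + 1) with rfl | hne
      · rw [Function.update_self, h2]
      · rw [Function.update_of_ne hne, h1 i (by omega)]
  have hU : {ω | ∀ i ≤ m, Y i ω = s i} ∩ B =
      ⋃ v, {ω | ∀ i ≤ m + 1, Y i ω = Function.update s (m + 1) v i} ∩ B := by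
    ext ω
    simp only [hpre, Set.mem_inter_iff, Set.mem_iUnion, Set.mem_preimage, Set.mem_singleton_iff]
    exact ⟨fun h => ⟨Y (m + 1) ω, ⟨h.1, rfl⟩, h.2⟩, fun ⟨v, h1, h2⟩ => ⟨h1.1, h2⟩⟩
  rw [hU, measure_iUnion]
  · have hv (v : ℤ) : P ({ω | ∀ i ≤ m + 1, Y i ω = Function.update s (m + 1) v i} ∩ B) =
        P {ω | ∀ i ≤ m, Y i ω = s i} *
          ENNReal.ofReal ((if |v - s m| = 1 then 1 / 2 else 0) * f v) := by
      rw [h v, hstep, Function.update_self, Function.update_of_ne (by omega),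
        ENNReal.ofReal_mul (by split_ifs <;> norm_num), mul_assoc]
      congr 3
      ext ω
      refine forall₂_congr fun i hi => ?_
      rw [Function.update_of_ne (by omega)]
    simp only [hv]
    rw [ENNReal.tsum_mul_left, tsum_eq_sum (s := {s m + 1, s m - 1}),
      Finset.sum_pair (by omega)]
    · rw [if_pos (by simp), if_pos (by simp), ← ENNReal.ofReal_add
        (mul_nonneg (by norm_num) (hf _)) (mul_nonneg (by norm_num) (hf _)), neighbourMean]
      congr 2
      ring
    · intro v hv
      simp only [Finset.mem_insert, Finset.mem_singleton, not_or] at hv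
      rw [if_neg, zero_mul, ENNReal.ofReal_zero]
      intro hv'
      rcases (abs_eq (by norm_num)).1 hv' with h' | h' <;> omega
  · intro v w hvw
    refine Set.disjoint_left.2 fun ω h1 h2 => hvw ?_
    beta_reduce at h1 h2
    rw [hpre] at h1 h2
    exact h1.1.2.symm.trans h2.1.2
  · intro v
    exact (measurableSet_prefix hY _ _).inter hB

/-- The Markov property at time `m`, in product form so that null prefixes need no separate
treatment. Each induction step lengthens the known prefix by one, hence the generality in `m` and
`s`. -/
lemma measure_prefix_inter_hitsBetween (hY : ∀ n, Measurable (Y n))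
    (hstep : ∀ (m : ℕ) (s : ℕ → ℤ), P {ω | ∀ i ≤ m + 1, Y i ω = s i} =
      P {ω | ∀ i ≤ m, Y i ω = s i} *
        ENNReal.ofReal (if |s (m + 1) - s m| = 1 then 1 / 2 else 0))
    {y z : ℤ} (hyz : y ≠ z) (n m : ℕ) (s : ℕ → ℤ) :
    P ({ω | ∀ i ≤ m, Y i ω = s i} ∩ {ω | HitsBetween y z m (m + n) fun i => Y i ω}) =
      P {ω | ∀ i ≤ m, Y i ω = s i} * ENNReal.ofReal (hitProb y z n (s m)) := by
  induction n generalizing m s with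
  | zero =>
    by_cases hy : s m = y
    · rw [hy, hitProb_self, ENNReal.ofReal_one, mul_one, Set.inter_eq_left.2]
      intro ω hω
      exact hitsBetween_of_eq hyz (by omega) ((hω m le_rfl).trans hy)
    · rw [hitProb, if_neg hy, ENNReal.ofReal_zero, mul_zero, Set.disjoint_iff_inter_eq_empty.1,
        measure_empty]
      refine Set.disjoint_left.2 fun ω h1 ⟨k, hk1, hk2, hk3, _⟩ => hy ?_
      rw [← h1 m le_rfl, ← hk3, le_antisymm hk2 hk1, add_zero]
  | succ n ih =>
    by_cases hy : s m = y
    · rw [hy, hitProb_self, ENNReal.ofReal_one, mul_one, Set.inter_eq_left.2]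
      intro ω hω
      exact hitsBetween_of_eq hyz (by omega) ((hω m le_rfl).trans hy)
    by_cases hz : s m = z
    · rw [hz, hitProb_taboo hyz, ENNReal.ofReal_zero, mul_zero,
        Set.disjoint_iff_inter_eq_empty.1, measure_empty]
      refine Set.disjoint_left.2 fun ω h1 h2 => ?_
      exact not_hitsBetween_of_eq ((h1 m le_rfl).trans hz) h2
    have hset : {ω | ∀ i ≤ m, Y i ω = s i} ∩
        {ω | HitsBetween y z m (m + (n + 1)) fun i => Y i ω} =
        {ω | ∀ i ≤ m, Y i ω = s i} ∩
          {ω | HitsBetween y z (m + 1) (m + 1 + n) fun i => Y i ω} := by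
      rw [show m + (n + 1) = m + 1 + n by ring]
      ext ω
      refine and_congr_right fun h => ?_
      have h' : Y m ω = s m := h m le_rfl
      exact hitsBetween_iff_succ (by rwa [h']) (by rwa [h'])
    rw [hset, hitProb, if_neg hy, if_neg hz]
    refine measure_prefix_inter_of_step hY hstep (measurableSet_hitsBetween_comp hY y z _ _)
      (fun v => (hitProb_mem_Icc y z n v).1) fun v => ?_
    rw [ih, Function.update_self]

/-- Time `0` is exempt from both target and taboo, so one free step precedes the Markov property at
time `1`; this permits `x = y` and `x = z`. -/
lemma measure_eq_inter_hitsBetween (hY : ∀ n, Measurable (Y n))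
    (hstep : ∀ (m : ℕ) (s : ℕ → ℤ), P {ω | ∀ i ≤ m + 1, Y i ω = s i} =
      P {ω | ∀ i ≤ m, Y i ω = s i} *
        ENNReal.ofReal (if |s (m + 1) - s m| = 1 then 1 / 2 else 0))
    {y z : ℤ} (hyz : y ≠ z) (n : ℕ) (x : ℤ) :
    P ({ω | Y 0 ω = x} ∩ {ω | HitsBetween y z 1 n fun i => Y i ω}) =
      P {ω | Y 0 ω = x} * ENNReal.ofReal (returnProb y z n x) := by
  cases n with
  | zero =>
    rw [returnProb, ENNReal.ofReal_zero, mul_zero, Set.disjoint_iff_inter_eq_empty.1,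
      measure_empty]
    exact Set.disjoint_left.2 fun ω _ h => not_hitsBetween_of_lt one_pos _ h
  | succ n =>
    have h0 : {ω | Y 0 ω = x} = {ω | ∀ i ≤ 0, Y i ω = (fun _ => x : ℕ → ℤ) i} := by
      ext ω
      exact ⟨fun h i hi => by rw [Nat.le_zero.1 hi]; exact h, fun h => h 0 le_rfl⟩
    rw [h0, returnProb]
    refine measure_prefix_inter_of_step (s := fun _ => x) hY hstep
      (measurableSet_hitsBetween_comp hY y z _ _)
      (fun v => (hitProb_mem_Icc y z n v).1) fun v => ?_
    rw [add_comm n 1]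
    have := measure_prefix_inter_hitsBetween hY hstep hyz n 1 (Function.update (fun _ => x) 1 v)
    rwa [Function.update_self] at this

/-- A step of size `0` has weight `0`, for each of countably many starting values. This identifies
the exit time with the first holding time. -/
lemma ae_first_step_ne (hstep : ∀ (m : ℕ) (s : ℕ → ℤ), P {ω | ∀ i ≤ m + 1, Y i ω = s i} =
      P {ω | ∀ i ≤ m, Y i ω = s i} *
        ENNReal.ofReal (if |s (m + 1) - s m| = 1 then 1 / 2 else 0)) :
    ∀ᵐ ω ∂P, Y 1 ω ≠ Y 0 ω := by
  have h : ∀ᵐ ω ∂P, ∀ v : ℤ, ¬ ∀ i ≤ 0 + 1, Y i ω = (fun _ => v : ℕ → ℤ) i := by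
    rw [ae_all_iff]
    intro v
    rw [ae_iff]
    simp only [not_not]
    rw [hstep 0 fun _ => v]
    simp
  filter_upwards [h] with ω hω h01
  refine hω (Y 0 ω) fun i hi => ?_
  rcases (show i = 0 ∨ i = 1 by omega) with rfl | rfl
  · rfl
  · exact h01

end Chain

/-! ### Hitting times in terms of the embedded chain -/

section Path

variable {s : ℝ≥0 → ℤ} {Y : ℕ → ℤ} {T : ℕ → ℝ}

lemma strictMono_sum_range (hT : ∀ n, 0 < T n) :
    StrictMono fun n => ∑ i ∈ Finset.range n, T i :=
  strictMono_nat_of_lt_succ fun n => by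
    rw [Finset.sum_range_succ]; linarith [hT n]

lemma exists_jump_index (hT' : ∀ t : ℝ, ∃ n, t < ∑ i ∈ Finset.range n, T i) (t : ℝ≥0) :
    ∃ n, ∑ i ∈ Finset.range n, T i ≤ (t : ℝ) ∧ (t : ℝ) < ∑ i ∈ Finset.range (n + 1), T i := by
  classical
  have h := Nat.find_spec (hT' t)
  have h0 : Nat.find (hT' t) ≠ 0 := by
    intro h0
    rw [h0, Finset.range_zero, Finset.sum_empty] at h
    exact absurd h (not_lt.2 t.2)
  obtain ⟨n, hn⟩ := Nat.exists_eq_succ_of_ne_zero h0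
  refine ⟨n, not_lt.1 (Nat.find_min (hT' t) (by omega)), ?_⟩
  rwa [hn] at h

lemma path_zero (hT : ∀ n, 0 < T n)
    (hs : ∀ (n : ℕ) (t : ℝ≥0), ∑ i ∈ Finset.range n, T i ≤ (t : ℝ) →
      (t : ℝ) < ∑ i ∈ Finset.range (n + 1), T i → s t = Y n) : s 0 = Y 0 :=
  hs 0 0 (by simp) (by simpa using hT 0)

lemma path_exitTime (hT : ∀ n, 0 < T n)
    (hs : ∀ (n : ℕ) (t : ℝ≥0), ∑ i ∈ Finset.range n, T i ≤ (t : ℝ) →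
      (t : ℝ) < ∑ i ∈ Finset.range (n + 1), T i → s t = Y n)
    (hY : Y 1 ≠ Y 0) : exitTime s = ENNReal.ofReal (T 0) := by
  have h0 := path_zero hT hs
  refine le_antisymm (sInf_le ⟨(T 0).toNNReal, ?_, rfl⟩) (le_sInf ?_)
  · have : s (T 0).toNNReal = Y 1 := by
      refine hs 1 _ ?_ ?_
      · simp [hT 0 |>.le]
      · rw [Real.coe_toNNReal _ (hT 0).le]
        simpa [Finset.sum_range_succ] using hT 1
    change s (T 0).toNNReal ≠ s 0
    rwa [this, h0]
  · rintro _ ⟨t, ht, rfl⟩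
    change ENNReal.ofReal (T 0) ≤ t
    rw [ENNReal.ofReal_le_coe]
    by_contra! hlt
    refine ht ?_
    rw [h0]
    exact hs 0 t (by simp) (by simpa using hlt)

/-- The path is constant between jumps, so between the exit time and `t` it runs through exactly `Y
1, …, Y n`. -/
lemma path_tabooHittingTime_le_iff (hT : ∀ n, 0 < T n)
    (hT' : ∀ t : ℝ, ∃ n, t < ∑ i ∈ Finset.range n, T i)
    (hs : ∀ (n : ℕ) (t : ℝ≥0), ∑ i ∈ Finset.range n, T i ≤ (t : ℝ) →
      (t : ℝ) < ∑ i ∈ Finset.range (n + 1), T i → s t = Y n)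
    (hY : Y 1 ≠ Y 0) (y z : ℤ) {n : ℕ} {t : ℝ≥0}
    (h1 : ∑ i ∈ Finset.range n, T i ≤ (t : ℝ))
    (h2 : (t : ℝ) < ∑ i ∈ Finset.range (n + 1), T i) :
    tabooHittingTime y z s ≤ t ↔ HitsBetween y z 1 n Y := by
  have hmono := strictMono_sum_range hT
  have hex := path_exitTime hT hs hY
  have hσ0 (k : ℕ) : 0 ≤ ∑ i ∈ Finset.range k, T i := Finset.sum_nonneg fun i _ => (hT i).le
  have hexit (u : ℝ≥0) : exitTime s ≤ u ↔ ∑ i ∈ Finset.range 1, T i ≤ (u : ℝ) := by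
    rw [hex, ENNReal.ofReal_le_coe]; simp
  have hidx {i j : ℕ} {u v : ℝ} (hu : ∑ i ∈ Finset.range i, T i ≤ u)
      (hv : v < ∑ i ∈ Finset.range (j + 1), T i) (huv : u ≤ v) : i ≤ j := by
    have := hmono.lt_iff_lt.1 (hu.trans_lt (huv.trans_lt hv))
    omega
  constructor
  · intro h
    by_contra hnot
    -- Bounding by the next jump time, which is strictly after `t`, excludes an infimum equal to `t`
    -- that is approached only from later times.
    have hge : ENNReal.ofReal (∑ i ∈ Finset.range (n + 1), T i) ≤ tabooHittingTime y z s := by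
      refine le_sInf ?_
      rintro _ ⟨u, ⟨hu1, hu2, hu3⟩, rfl⟩
      change ENNReal.ofReal _ ≤ (u : ℝ≥0∞)
      rw [ENNReal.ofReal_le_coe]
      by_contra! hlt
      obtain ⟨k, hk1, hk2⟩ := exists_jump_index hT' u
      refine hnot ⟨k, hidx ((hexit u).1 hu1) hk2 le_rfl, ?_, ?_, ?_⟩
      · exact hidx hk1 hlt le_rfl
      · rw [← hs k u hk1 hk2, hu2]
      · intro j hj hjk
        have hj' : ((∑ i ∈ Finset.range j, T i).toNNReal : ℝ) = ∑ i ∈ Finset.range j, T i :=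
          Real.coe_toNNReal _ (hσ0 j)
        rw [← hs j (∑ i ∈ Finset.range j, T i).toNNReal hj'.ge
          (by rw [hj']; exact hmono (Nat.lt_succ_self j))]
        refine hu3 _ ((hexit _).2 ?_) ?_
        · rw [hj']; exact hmono.monotone hj
        · rw [← NNReal.coe_le_coe, hj']
          exact (hmono.monotone hjk).trans hk1
    have := hge.trans h
    rw [ENNReal.ofReal_le_coe] at this
    linarith
  · rintro ⟨k, hk1, hk2, hk3, hk4⟩
    have hk' : ((∑ i ∈ Finset.range k, T i).toNNReal : ℝ) = ∑ i ∈ Finset.range k, T i :=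
      Real.coe_toNNReal _ (hσ0 k)
    have hle : tabooHittingTime y z s ≤ ((∑ i ∈ Finset.range k, T i).toNNReal : ℝ≥0∞) := by
      refine sInf_le ⟨(∑ i ∈ Finset.range k, T i).toNNReal, ⟨?_, ?_, ?_⟩, rfl⟩
      · rw [hexit, hk']; exact hmono.monotone hk1
      · rw [hs k _ hk'.ge (by rw [hk']; exact hmono (Nat.lt_succ_self k)), hk3]
      · intro u hu1 hu2
        obtain ⟨j, hj1, hj2⟩ := exists_jump_index hT' u
        rw [hs j u hj1 hj2]
        rw [← NNReal.coe_le_coe, hk'] at hu2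
        exact hk4 j (hidx ((hexit u).1 hu1) hj2 le_rfl)
          (hmono.le_iff_le.1 (hj1.trans hu2))
    refine hle.trans ?_
    rw [ENNReal.coe_le_coe, ← NNReal.coe_le_coe, hk']
    exact (hmono.monotone hk2).trans h1

end Path

/-- The distribution function of the taboo hitting time is a Poisson average of the
distribution function of the corresponding hitting time of the embedded chain. -/
theorem tabooCDF_eq_poissonMix {Ω : Type*} [MeasurableSpace Ω] (P : Measure Ω)
    [IsProbabilityMeasure P] {a : ℝ} (ha : 0 < a) {S : ℝ≥0 → Ω → ℤ}
    (hS : IsRandomWalk (simpleGenerator a) S P) {x y z : ℤ} (hyz : y ≠ z)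
    (hx : P {ω | S 0 ω = x} ≠ 0) (t : ℝ≥0) :
    tabooCDF S P x y z t = poissonMix (fun n => returnProb y z n x) (a * t) := by
  obtain ⟨hSm, Y, T, hY, hT, hchain, hlaw, hind, hYT, hpath⟩ := hS
  have hrate : jumpRate (simpleGenerator a) = a := by simp [jumpRate, simpleGenerator]
  rw [hrate] at hlaw
  have hstep (m : ℕ) (s : ℕ → ℤ) : P {ω | ∀ i ≤ m + 1, Y i ω = s i} =
      P {ω | ∀ i ≤ m, Y i ω = s i} *
        ENNReal.ofReal (if |s (m + 1) - s m| = 1 then 1 / 2 else 0) := by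
    rw [hchain, hchain, Finset.prod_range_succ, embeddedProb_simpleGenerator ha, mul_assoc]
  have hpos := ae_pos_of_map_eq_expMeasure ha hT hlaw
  have hunb := ae_unbounded_sum ha hT hlaw hind
  have hne := ae_first_step_ne hstep
  have hS0 : P {ω | S 0 ω = x} = P {ω | Y 0 ω = x} := by
    refine measure_congr ?_
    filter_upwards [hpos, hpath] with ω h1 h2
    exact congrArg (· = x) (path_zero (s := fun u => S u ω) (Y := fun n => Y n ω) h1 h2)
  have hl : 0 ≤ a * (t : ℝ) := by positivity
  have hl0 (n : ℕ) := poissonWeight_nonneg hl n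
  have hr0 (n : ℕ) := (returnProb_mem_Icc y z n x).1
  have hr1 (n : ℕ) : |returnProb y z n x| ≤ 1 := by
    rw [abs_of_nonneg (hr0 n)]; exact (returnProb_mem_Icc y z n x).2
  set C : ℕ → Set Ω := fun n => {ω | Y 0 ω = x} ∩ {ω | HitsBetween y z 1 n fun i => Y i ω}
  set D : ℕ → Set Ω := fun n =>
    {ω | ∑ i ∈ Finset.range n, T i ω ≤ t ∧ t < ∑ i ∈ Finset.range (n + 1), T i ω} with hD
  have hCm' (n : ℕ) :
      MeasurableSet ({s : ℕ → ℤ | s 0 = x} ∩ {s : ℕ → ℤ | HitsBetween y z 1 n s}) :=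
    (measurableSet_eq_fun (measurable_pi_apply 0) measurable_const).inter
      (measurableSet_hitsBetween y z 1 n)
  have hsum (n : ℕ) : Measurable fun r : ℕ → ℝ => ∑ i ∈ Finset.range n, r i := by fun_prop
  have hDm' (n : ℕ) : MeasurableSet ({r : ℕ → ℝ | ∑ i ∈ Finset.range n, r i ≤ t} ∩
      {r : ℕ → ℝ | t < ∑ i ∈ Finset.range (n + 1), r i}) :=
    (measurableSet_le (hsum n) measurable_const).inter
      (measurableSet_lt measurable_const (hsum (n + 1)))
  have hCm (n : ℕ) : MeasurableSet (C n) := measurable_pi_lambda (fun ω i => Y i ω) hY (hCm' n)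
  have hDm (n : ℕ) : MeasurableSet (D n) := measurable_pi_lambda (fun ω i => T i ω) hT (hDm' n)
  have hDC (n : ℕ) : P (D n ∩ C n) = P {ω | Y 0 ω = x} *
      ENNReal.ofReal (poissonWeight (a * t) n * returnProb y z n x) := by
    have h := hYT.measure_inter_preimage_eq_mul _ _ (hDm' n) (hCm' n)
    refine h.trans ?_
    change P (D n) * P (C n) = _
    rw [measure_eq_inter_hitsBetween hY hstep hyz,
      (measure_jumpCount ha hT hlaw hind n t.2 : P (D n) = _), ENNReal.ofReal_mul (hl0 n)]
    ring
  -- Split by the number of jumps up to `t`: `D n` depends only on the holding times, `C n` only on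
  -- the chain.
  have hE : ({ω | S 0 ω = x} ∩ {ω | tabooHittingTime y z (fun u => S u ω) ≤ t} : Set Ω) =ᵐ[P]
      ⋃ n, D n ∩ C n := by
    filter_upwards [hpos, hunb, hne, hpath] with ω h1 h2 h3 h4
    have h0 : S 0 ω = Y 0 ω := path_zero (s := fun u => S u ω) (Y := fun n => Y n ω) h1 h4
    have key {n : ℕ} (hn : ω ∈ D n) : tabooHittingTime y z (fun u => S u ω) ≤ t ↔
        HitsBetween y z 1 n fun i => Y i ω :=
      path_tabooHittingTime_le_iff (s := fun u => S u ω) (Y := fun n => Y n ω)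
        h1 h2 h4 h3 y z hn.1 hn.2
    refine propext ?_
    change (S 0 ω = x ∧ tabooHittingTime y z (fun u => S u ω) ≤ t) ↔ ω ∈ ⋃ n, D n ∩ C n
    rw [h0, Set.mem_iUnion]
    constructor
    · rintro ⟨hx, hτ⟩
      obtain ⟨n, hn⟩ := exists_jump_index h2 t
      exact ⟨n, hn, hx, (key hn).1 hτ⟩
    · rintro ⟨n, hn, hx, hh⟩
      exact ⟨hx, (key hn).2 hh⟩
  -- Disjointness is only almost sure, since it relies on positive holding times.
  have hdisj : Pairwise (Function.onFun (AEDisjoint P) fun n => D n ∩ C n) := by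
    intro m n hmn
    refine measure_mono_null (t := {ω | ¬ ∀ n, 0 < T n ω}) ?_ hpos
    rintro ω ⟨⟨hm, -⟩, ⟨hn, -⟩⟩ hT0
    have hmono := strictMono_sum_range hT0
    have h1 := hmono.lt_iff_lt.1 (hm.1.trans_lt hn.2)
    have h2 := hmono.lt_iff_lt.1 (hn.1.trans_lt hm.2)
    omega
  have hx' : P {ω | Y 0 ω = x} ≠ 0 := hS0 ▸ hx
  have hmix := summable_poissonWeight_mul hl hr1
  rw [tabooCDF, measureReal_def, cond_apply (measurableSet_eq_fun (hSm 0) measurable_const),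
    measure_congr hE, measure_iUnion₀ hdisj fun n => ((hDm n).inter (hCm n)).nullMeasurableSet]
  simp only [hDC]
  rw [ENNReal.tsum_mul_left, hS0, ← mul_assoc, ENNReal.inv_mul_cancel hx' (measure_ne_top P _),
    one_mul, ← ENNReal.ofReal_tsum_of_nonneg (fun n => mul_nonneg (hl0 n) (hr0 n)) hmix,
    ENNReal.toReal_ofReal (tsum_nonneg fun n => mul_nonneg (hl0 n) (hr0 n))]
  rfl

/-! ### Asymptotics -/

lemma tendsto_sqrt_mul_poissonMix_coe {a c : ℝ} (ha : 0 < a) {q : ℕ → ℝ}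
    (hq : Tendsto (fun n : ℕ => √((n : ℝ) + 1) * q n) atTop (nhds c)) :
    Tendsto (fun t : ℝ≥0 => √(t : ℝ) * poissonMix q (a * t)) atTop (nhds (c / √a)) := by
  have h := ((tendsto_sqrt_mul_poissonMix hq).comp
    ((NNReal.tendsto_coe_atTop.2 tendsto_id).const_mul_atTop ha)).div_const √a
  refine h.congr fun t => ?_
  have : √a ≠ 0 := (Real.sqrt_pos.2 ha).ne'
  simp only [Function.comp_apply, id_eq]
  rw [Real.sqrt_mul ha.le]
  field_simp

lemma isEquivalent_of_tendsto_sqrt_mul {f g : ℝ≥0 → ℝ} {c : ℝ} (hc : c ≠ 0)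
    (hf : Tendsto (fun t : ℝ≥0 => √(t : ℝ) * f t) atTop (nhds c))
    (hg : ∀ t, g t = c / √(t : ℝ)) : f ~[atTop] g := by
  have hpos : ∀ᶠ t : ℝ≥0 in atTop, √(t : ℝ) ≠ 0 := by
    filter_upwards [eventually_gt_atTop 0] with t ht
    exact (Real.sqrt_pos.2 (by exact_mod_cast ht)).ne'
  rw [isEquivalent_iff_tendsto_one]
  · refine ((hf.div_const c).congr' ?_).trans (by rw [div_self hc])
    filter_upwards [hpos] with t ht
    simp only [Pi.div_apply, hg]
    field_simp
  · filter_upwards [hpos] with t ht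
    rw [hg]
    exact div_ne_zero hc ht

lemma isLittleO_poissonMix {a r C ε : ℝ} (ha : 0 < a) (hε : ε < 1 - r) {q : ℕ → ℝ}
    (hq : ∀ n, |q n| ≤ C * r ^ n) :
    (fun t : ℝ≥0 => poissonMix q (a * t)) =o[atTop] fun t : ℝ≥0 => Real.exp (-a * ε * t) := by
  have hO : (fun t : ℝ≥0 => poissonMix q (a * t)) =O[atTop]
      fun t : ℝ≥0 => Real.exp (-(1 - r) * (a * t)) := by
    refine IsBigO.of_bound C (Eventually.of_forall fun t => ?_)
    rw [Real.norm_of_nonneg (Real.exp_pos _).le]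
    exact abs_poissonMix_le (by positivity) hq
  refine hO.trans_isLittleO ?_
  refine Real.isLittleO_exp_comp_exp_comp.2 ?_
  have h : 0 < a * (1 - r - ε) := mul_pos ha (by linarith)
  refine ((NNReal.tendsto_coe_atTop.2 tendsto_id).const_mul_atTop h).congr fun t => ?_
  simp only [id_eq]; ring

lemma poissonMix_const_sub_returnProb {l : ℝ} (hl : 0 ≤ l) (c : ℝ) (y z x : ℤ) :
    c - poissonMix (fun n => returnProb y z n x) l =
      poissonMix (fun n => c - returnProb y z n x) l :=
  (poissonMix_const_sub hl (B := 1) (fun n => by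
    rw [abs_of_nonneg (returnProb_mem_Icc y z n x).1]
    exact (returnProb_mem_Icc y z n x).2) c).symm

/-- The rate of decay of the walk confined to an interval of length `L`. -/
noncomputable def ruinRate (L : ℝ) : ℝ := 1 - 1 / (2 * L ^ 2)

section HittingAsymptotics

variable {a : ℝ} {x y z : ℤ}

lemma isEquivalent_hit (ha : 0 < a) (hxy : x < y) (hyz : y < z) :
    (fun t : ℝ≥0 => 1 - poissonMix (fun n => returnProb y z n x) (a * t)) ~[atTop]
      fun t : ℝ≥0 => √2 * |(y : ℝ) - x| / (√(a * Real.pi) * √(t : ℝ)) := by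
  obtain ⟨d, hd⟩ := Int.eq_ofNat_of_zero_le (show 0 ≤ y - x by omega)
  have hd' : (y : ℝ) - x = d := by exact_mod_cast congrArg (Int.cast : ℤ → ℝ) hd
  have hd0 : (d : ℝ) ≠ 0 := by
    have : d ≠ 0 := by omega
    exact_mod_cast this
  have hq : (fun n => 1 - returnProb y z n x) = fun n => survival n d := by
    ext n
    rw [returnProb_eq_hitProb (by omega) (by omega), hitProb_eq_one_sub_survival hyz n hxy.le, hd]
    ring
  refine isEquivalent_of_tendsto_sqrt_mul (c := d * √(2 / Real.pi) / √a) ?_ ?_ fun t => ?_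
  · positivity
  · refine (tendsto_sqrt_mul_poissonMix_coe ha (tendsto_sqrt_mul_survival d)).congr fun t => ?_
    rw [poissonMix_const_sub_returnProb (by positivity), hq]
  · rw [hd', abs_of_nonneg (Nat.cast_nonneg d), Real.sqrt_div (by norm_num), Real.sqrt_mul ha.le]
    field_simp

lemma abs_ruin_sub_hitProb_le (hyz : y < z) (n : ℕ) (hy : y ≤ x) (hz : x ≤ z) :
    |((z : ℝ) - x) / ((z : ℝ) - y) - hitProb y z n x| ≤
      (((x : ℝ) - y) * (z - x)) * ruinRate ((z : ℝ) - y) ^ n := by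
  have h := ruin_sub_hitProb_mem_Icc hyz n hy hz
  rw [abs_of_nonneg h.1, mul_comm]
  exact h.2

/-- The lower bound lets the factor `1 / 2` of a first step pay for the extra power of the rate in
`abs_sub_returnProb_taboo_le`. -/
lemma ruinRate_mem_Ico (hyz : y < z) : ruinRate ((z : ℝ) - y) ∈ Set.Ico (1 / 2 : ℝ) 1 := by
  have hL : (1 : ℝ) ≤ (z : ℝ) - y := by exact_mod_cast (show 1 ≤ z - y by omega)
  have h1 : 1 / (2 * ((z : ℝ) - y) ^ 2) ≤ 1 / 2 := by
    apply one_div_le_one_div_of_le <;> nlinarith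
  have h2 : 0 < 1 / (2 * ((z : ℝ) - y) ^ 2) := by positivity
  unfold ruinRate
  constructor <;> linarith

lemma abs_sub_returnProb_taboo_le (hyz : y < z) :
    ∃ C, ∀ n, |1 / (2 * ((z : ℝ) - y)) - returnProb y z n z| ≤
      C * ruinRate ((z : ℝ) - y) ^ n := by
  obtain ⟨hr0, hr1⟩ := ruinRate_mem_Ico hyz
  have hL : (1 : ℝ) ≤ (z : ℝ) - y := by exact_mod_cast (show 1 ≤ z - y by omega)
  set r := ruinRate ((z : ℝ) - y) with hr
  set L := (z : ℝ) - y with hLdef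
  -- `L` dominates the quadratic weight `L - 1` at the starting point `z - 1`; the choice also
  -- covers `n = 0`.
  refine ⟨L + 1, fun n => ?_⟩
  cases n with
  | zero =>
    rw [returnProb, sub_zero, abs_of_nonneg (by positivity), pow_zero, mul_one,
      div_le_iff₀ (by positivity)]
    nlinarith
  | succ n =>
    have h := abs_ruin_sub_hitProb_le hyz n (x := z - 1) (by omega) (by omega)
    rw [← hr, ← hLdef] at h
    push_cast at h
    rw [returnProb, neighbourMean, hitProb_eq_zero hyz n (by omega : z ≤ z + 1)]
    have e : 1 / (2 * L) - (0 + hitProb y z n (z - 1)) / 2 =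
        (((z : ℝ) - (z - 1)) / L - hitProb y z n (z - 1)) / 2 := by
      field_simp; ring
    rw [e, abs_div, abs_of_pos (two_pos : (0 : ℝ) < 2), pow_succ]
    have hp : 0 ≤ r ^ n := by positivity
    have hz : ((z : ℝ) - 1 - y) * (z - (z - 1)) ≤ L := by rw [hLdef]; linarith
    have h' := h.trans (mul_le_mul_of_nonneg_right hz hp)
    have : L * r ^ n * (1 / 2) ≤ L * r ^ n * r := mul_le_mul_of_nonneg_left hr0 (by positivity)
    have : 0 ≤ r ^ n * r := by positivity
    linarith

lemma tendsto_sqrt_mul_geom {q : ℕ → ℝ} {C r : ℝ} (hr0 : 0 ≤ r) (hr : r < 1)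
    (hq : ∀ n, |q n| ≤ C * r ^ n) :
    Tendsto (fun n : ℕ => √((n : ℝ) + 1) * q n) atTop (nhds 0) := by
  have h1 : Tendsto (fun n : ℕ => C * (n * r ^ n + r ^ n)) atTop (nhds 0) := by
    simpa using ((tendsto_self_mul_const_pow_of_lt_one hr0 hr).add
      (tendsto_pow_atTop_nhds_zero_of_lt_one hr0 hr)).const_mul C
  refine squeeze_zero_norm (fun n => ?_) h1
  rw [norm_mul, Real.norm_of_nonneg (Real.sqrt_nonneg _), Real.norm_eq_abs]
  have h2 : √((n : ℝ) + 1) ≤ n + 1 := (Real.sqrt_le_left (by positivity)).2 (by nlinarith)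
  calc _ ≤ ((n : ℝ) + 1) * (C * r ^ n) :=
        mul_le_mul h2 (hq n) (abs_nonneg _) (by positivity)
    _ = _ := by ring

/-- After a step down the walk survives at distance `1`; after a step up the error is geometric and
negligible. Only the first half contributes, whence the halved constant. -/
lemma isEquivalent_return (ha : 0 < a) (hyz : y < z) :
    (fun t : ℝ≥0 => 1 - 1 / (2 * |(y : ℝ) - z|) -
        poissonMix (fun n => returnProb y z n y) (a * t)) ~[atTop]
      fun t : ℝ≥0 => 1 / (√(2 * a * Real.pi) * √(t : ℝ)) := by
  have hL : (1 : ℝ) ≤ (z : ℝ) - y := by exact_mod_cast (show 1 ≤ z - y by omega)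
  obtain ⟨hr0, hr1⟩ := ruinRate_mem_Ico hyz
  have hq : Tendsto (fun n : ℕ => √((n : ℝ) + 1) *
      (1 - 1 / (2 * |(y : ℝ) - z|) - returnProb y z n y)) atTop
      (nhds (√(2 / Real.pi) / 2)) := by
    refine (tendsto_add_atTop_iff_nat 1).1 ?_
    have h1 := tendsto_sqrt_mul_survival_one
    have h2 := tendsto_sqrt_mul_geom (by linarith) hr1 fun n =>
      abs_ruin_sub_hitProb_le hyz n (x := y + 1) (by omega) (by omega)
    have h3 : Tendsto (fun n : ℕ => (√(((n : ℝ) + 1) / (n + 1 + 1)))⁻¹) atTop (nhds 1) := by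
      simpa using tendsto_sqrt_add_one_div.inv₀ one_ne_zero
    have h4 := (h3.mul (h1.add h2)).div_const 2
    rw [one_mul, add_zero] at h4
    refine h4.congr fun n => ?_
    rw [← Real.sqrt_inv, inv_div, mul_add, ← mul_assoc, ← mul_assoc,
      ← Real.sqrt_mul (by positivity), div_mul_cancel₀ _ (by positivity)]
    rw [returnProb, neighbourMean, hitProb_eq_one_sub_survival hyz n (x := y - 1) (by omega),
      show y - (y - 1) = 1 by ring, abs_of_nonpos (by linarith)]
    push_cast
    have : 1 / (2 * -((y : ℝ) - z)) = 1 / 2 * (1 / (z - y)) := by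
      rw [neg_sub]; field_simp
    rw [this]
    have : ((z : ℝ) - (y + 1)) / (z - y) = 1 - 1 / (z - y) := by
      have : (z : ℝ) - y ≠ 0 := by linarith
      field_simp; ring
    rw [this]; ring
  refine isEquivalent_of_tendsto_sqrt_mul (c := √(2 / Real.pi) / 2 / √a) ?_ ?_ fun t => ?_
  · positivity
  · refine (tendsto_sqrt_mul_poissonMix_coe ha hq).congr fun t => ?_
    rw [poissonMix_const_sub_returnProb (by positivity)]
  · rw [Real.sqrt_div (by norm_num), Real.sqrt_mul (by positivity), Real.sqrt_mul (by norm_num)]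
    have h2 : √(2 : ℝ) ^ 2 = 2 := Real.sq_sqrt (by norm_num)
    have := Real.sqrt_pos.2 ha
    field_simp
    rw [h2]

/-- The asymptotics of the taboo hitting probabilities when the taboo state lies to the right. -/
lemma poissonMix_returnProb_asymptotics (ha : 0 < a) (x : ℤ) (hyz : y < z) :
    ∃ ε ∈ Set.Ioo (0 : ℝ) 1,
      (x < y →
        (fun t : ℝ≥0 => 1 - poissonMix (fun n => returnProb y z n x) (a * t)) ~[atTop]
          fun t : ℝ≥0 => √2 * |(y : ℝ) - x| / (√(a * Real.pi) * √(t : ℝ))) ∧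
      (x = y →
        (fun t : ℝ≥0 => 1 - 1 / (2 * |(y : ℝ) - z|) -
            poissonMix (fun n => returnProb y z n y) (a * t)) ~[atTop]
          fun t : ℝ≥0 => 1 / (√(2 * a * Real.pi) * √(t : ℝ))) ∧
      (y < x ∧ x < z →
        (fun t : ℝ≥0 => ((x : ℝ) - z) / ((y : ℝ) - z) -
            poissonMix (fun n => returnProb y z n x) (a * t)) =o[atTop]
          fun t : ℝ≥0 => Real.exp (-a * ε * t)) ∧
      (x = z →
        (fun t : ℝ≥0 => 1 / (2 * |(y : ℝ) - z|) -
            poissonMix (fun n => returnProb y z n z) (a * t)) =o[atTop]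
          fun t : ℝ≥0 => Real.exp (-a * ε * t)) ∧
      (z < x → ∀ t : ℝ≥0, poissonMix (fun n => returnProb y z n x) (a * t) = 0) := by
  have hL : (1 : ℝ) ≤ (z : ℝ) - y := by exact_mod_cast (show 1 ≤ z - y by omega)
  obtain ⟨hr0, hr1⟩ := ruinRate_mem_Ico hyz
  -- Half the available exponent `1 - r`: the strict gap turns the geometric bound into little-o.
  refine ⟨(1 - ruinRate ((z : ℝ) - y)) / 2, ⟨by linarith, by linarith⟩,
    fun hx => isEquivalent_hit ha hx hyz, fun _ => isEquivalent_return ha hyz,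
    fun hx => ?_, fun hx => ?_, fun hx t => ?_⟩
  · refine (isLittleO_poissonMix ha (r := ruinRate ((z : ℝ) - y)) (by linarith) fun n =>
      abs_ruin_sub_hitProb_le hyz n hx.1.le hx.2.le).congr_left fun t => ?_
    rw [poissonMix_const_sub_returnProb (by positivity), ← neg_div_neg_eq, neg_sub, neg_sub]
    simp only [returnProb_eq_hitProb hx.1.ne' hx.2.ne]
  · obtain ⟨C, hC⟩ := abs_sub_returnProb_taboo_le hyz
    refine (isLittleO_poissonMix ha (r := ruinRate ((z : ℝ) - y)) (by linarith)
      hC).congr_left fun t => ?_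
    rw [poissonMix_const_sub_returnProb (by positivity), abs_of_nonpos (by linarith), neg_sub]
  · have (n : ℕ) : returnProb y z n x = 0 := by
      rw [returnProb_eq_hitProb (by omega) (by omega), hitProb_eq_zero hyz n hx.le]
    simp [poissonMix, this]

end HittingAsymptotics

theorem theorem2 {Ω : Type*} [MeasurableSpace Ω] (P : Measure Ω) [IsProbabilityMeasure P]
    (a : ℝ) (ha : 0 < a) (S : ℝ≥0 → Ω → ℤ) (hS : IsRandomWalk (simpleGenerator a) S P)
    (x y z : ℤ) (hyz : y ≠ z) (hx : P {ω | S 0 ω = x} ≠ 0) :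
    ∃ ε ∈ Set.Ioo (0 : ℝ) 1,
      ((x < y ∧ y < z) ∨ (z < y ∧ y < x) →
        (fun t : ℝ≥0 => 1 - tabooCDF S P x y z t) ~[atTop]
          fun t : ℝ≥0 => √2 * |(y : ℝ) - x| / (√(a * Real.pi) * √(t : ℝ))) ∧
      (x = y →
        (fun t : ℝ≥0 => 1 - 1 / (2 * |(y : ℝ) - z|) - tabooCDF S P y y z t) ~[atTop]
          fun t : ℝ≥0 => 1 / (√(2 * a * Real.pi) * √(t : ℝ))) ∧
      ((z < x ∧ x < y) ∨ (y < x ∧ x < z) →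
        (fun t : ℝ≥0 => ((x : ℝ) - z) / ((y : ℝ) - z) - tabooCDF S P x y z t) =o[atTop]
          fun t : ℝ≥0 => Real.exp (-a * ε * t)) ∧
      (x = z →
        (fun t : ℝ≥0 => 1 / (2 * |(y : ℝ) - z|) - tabooCDF S P z y z t) =o[atTop]
          fun t : ℝ≥0 => Real.exp (-a * ε * t)) ∧
      ((x < z ∧ z < y) ∨ (y < z ∧ z < x) →
        ∀ t : ℝ≥0, tabooCDF S P x y z t = 0) := by
  -- Two of the claims name the start as `y` or `z`; positivity of the conditioning event is known
  -- only for `x`, hence the equation `x = w`.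
  have hH (w : ℤ) (hw : x = w) (t : ℝ≥0) :
      tabooCDF S P w y z t = poissonMix (fun n => returnProb y z n w) (a * t) := by
    subst hw
    exact tabooCDF_eq_poissonMix P ha hS hyz hx t
  rcases lt_or_gt_of_ne hyz with h | h
  · obtain ⟨ε, hε, h1, h2, h3, h4, h5⟩ := poissonMix_returnProb_asymptotics ha x h
    refine ⟨ε, hε, fun hc => ?_, fun hc => ?_, fun hc => ?_, fun hc => ?_, fun hc => ?_⟩
    · simp only [hH x rfl]; exact h1 (by omega)
    · simp only [hH y hc]; exact h2 hc
    · simp only [hH x rfl]; exact h3 (by omega)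
    · simp only [hH z hc]; exact h4 hc
    · simp only [hH x rfl]; exact h5 (by omega)
  -- The reflection `v ↦ -v` preserves the discrete probabilities and moves the taboo state to the
  -- right of the target.
  · obtain ⟨ε, hε, h1, h2, h3, h4, h5⟩ :=
      poissonMix_returnProb_asymptotics ha (-x) (neg_lt_neg h)
    simp only [returnProb_neg, Int.cast_neg, neg_sub_neg] at h1 h2 h3 h4 h5
    refine ⟨ε, hε, fun hc => ?_, fun hc => ?_, fun hc => ?_, fun hc => ?_, fun hc => ?_⟩
    · simp only [hH x rfl]; rw [abs_sub_comm]; exact h1 (by omega)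
    · simp only [hH y hc]; rw [abs_sub_comm]; exact h2 (by omega)
    · simp only [hH x rfl]
      rw [← neg_div_neg_eq, neg_sub, neg_sub]
      exact h3 (by omega)
    · simp only [hH z hc]; rw [abs_sub_comm]; exact h4 (by omega)
    · simp only [hH x rfl]; exact h5 (by omega)
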